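/- Let $\mathbb T=\mathbb R/(2\pi\mathbb Z)$, let $c\in\mathbb R\setminus\{0\}$, $T>2\pi/|c|$, and let $q\in L^\infty(\mathbb T\times(0,T))$ be real valued. Let $\omega\subset\mathbb T$ be a nonempty open set. Assume that the real-valued function $u\in L^\infty(0,T;H^1(\mathbb T))$ satisfies $$u_t-u_{txx}-c\,u_{xxx}+q\,u_x=0\qquad\text{in }\mathbb T\times(0,T)$$ in the sense of distributions, that is, $$\int_0^T\!\!\int_{\mathbb T}\bigl(-u\,\varphi_t+u\,\varphi_{txx}+c\,u\,\varphi_{xxx}+q\,u_x\,\varphi\bigr)\,dx\,dt=0\qquad\text{for all }\varphi\in C_c^\infty(\mathbb T\times(0,T)),$$ where $u_x$ is the weak derivative of $u$ in $x$, and that $u(x,t)=0$ for almost every $(x,t)\in\omega\times(0,T)$. Then $u(x,t)=0$ for almost every $(x,t)\in\mathbb T\times(0,T)$. -/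

import Mathlib

open MeasureTheory Set

namespace KdVBBM

open scoped ContDiff

instance fact_two_pi_pos : Fact (0 < 2 * Real.pi) := ⟨Real.two_pi_pos⟩

/-- The one-dimensional torus `ℝ / 2πℤ`; its `volume` has total mass `2π`. -/
abbrev Torus : Type := AddCircle (2 * Real.pi)

/-- Lebesgue measure on the space-time cylinder `Torus × (0, T)`. -/
noncomputable def cylinder (T : ℝ) : Measure (Torus × ℝ) :=
  (volume : Measure Torus).prod (volume.restrict (Ioo 0 T))

/-- The derivative of a function on the torus. -/
noncomputable def torusDeriv (φ : Torus → ℝ) : Torus → ℝ :=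
  fun x => deriv (fun s : ℝ => φ (x + (s : Torus))) 0

/-- The partial derivative in `x` of a function of `(x, t)`. -/
noncomputable def dx (φ : Torus × ℝ → ℝ) : Torus × ℝ → ℝ :=
  fun p => deriv (fun s : ℝ => φ (p.1 + (s : Torus), p.2)) 0

/-- The partial derivative in `t` of a function of `(x, t)`. -/
noncomputable def dt (φ : Torus × ℝ → ℝ) : Torus × ℝ → ℝ :=
  fun p => deriv (fun s : ℝ => φ (p.1, s)) p.2

/-- `φ` is a `C^∞` function on the torus (its periodic lift to `ℝ` is smooth). -/
def SmoothOnTorus (φ : Torus → ℝ) : Prop :=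
  ContDiff ℝ ∞ (fun x : ℝ => φ (x : Torus))

/-- `φ` is a test function: `C^∞` on `Torus × ℝ`, with compact support contained in
`Torus × (0, T)`. -/
structure IsTestFunction (T : ℝ) (φ : Torus × ℝ → ℝ) : Prop where
  smooth : ContDiff ℝ ∞ (fun p : ℝ × ℝ => φ ((p.1 : Torus), p.2))
  compactSupport : HasCompactSupport φ
  tsupport_subset : tsupport φ ⊆ univ ×ˢ Ioo 0 T

/-- `f` belongs to the Sobolev space `H¹` of the torus, and `g` is its weak derivative. -/
structure HasH1Deriv (f g : Torus → ℝ) : Prop where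
  memLp : MemLp f 2 volume
  memLp_deriv : MemLp g 2 volume
  integral_eq : ∀ φ : Torus → ℝ, SmoothOnTorus φ →
    ∫ x, f x * torusDeriv φ x = - ∫ x, g x * φ x

/-- `u ∈ L^∞(0, T; H¹(Torus))`: `u` is measurable in `(x, t)`, and for almost every `t ∈ (0, T)`
the function `u(·, t)` is in `H¹` with norm at most a constant that does not depend on `t`.
(Since `H¹` is separable, joint measurability is the strong measurability of `t ↦ u(·, t)`.) -/
def MemLinftyH1 (T : ℝ) (u : Torus × ℝ → ℝ) : Prop :=
  AEStronglyMeasurable u (cylinder T) ∧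
  ∃ C : ℝ, ∀ᵐ t ∂(volume.restrict (Ioo 0 T)), ∃ g : Torus → ℝ,
    HasH1Deriv (fun x => u (x, t)) g ∧
    Real.sqrt ((∫ x : Torus, (u (x, t)) ^ 2) + ∫ x : Torus, (g x) ^ 2) ≤ C

/-- `v` is (a jointly measurable version of) the weak derivative `u_x` on `Torus × (0, T)`. -/
def IsWeakDx (T : ℝ) (u v : Torus × ℝ → ℝ) : Prop :=
  AEStronglyMeasurable v (cylinder T) ∧
  ∀ᵐ t ∂(volume.restrict (Ioo 0 T)), HasH1Deriv (fun x => u (x, t)) (fun x => v (x, t))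

/-- `u` solves `u_t - u_{txx} - c u_{xxx} + q u_x = 0` on `Torus × (0, T)` in the sense of
distributions: all derivatives except the one in the product `q u_x` are moved to the test
function. -/
def IsWeakSolution (c T : ℝ) (q u : Torus × ℝ → ℝ) : Prop :=
  ∃ v : Torus × ℝ → ℝ, IsWeakDx T u v ∧
    ∀ φ : Torus × ℝ → ℝ, IsTestFunction T φ →
      ∫ p, (- (u p * dt φ p) + u p * dt (dx (dx φ)) p + c * (u p * dx (dx (dx φ)) p)
        + q p * v p * φ p) ∂(cylinder T) = 0

end KdVBBM

/-! With `z = u + u_x` the equation factorizes: `(1 - ∂_x²)(∂_t + c ∂_x) u = (c - q) u_x`, hence `(1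
- ∂_x)(∂_t + c ∂_x) z = (c - q) u_x` (`integral_sum_mul_transport`). Cutting the torus at a point of
`ω` gives a solution supported in a rectangle of width `2π` (`planeSolution_indicator`), so large
exponential weights in `x` are allowed.

The weight is `exp (s (x - c t) + μ t)` times a time cut-off `χ`. The phase `x - c t` is constant
along the characteristics, so `s` costs nothing in the transport factor. The two first-order factors
in `x` are inverted with norm at most `1` once `|s| ≥ 2`. The parameter `μ` gains `1 / |μ|` in the
transport factor, so a `μ` fixed independently of `s` absorbs the bounded term `(c - q) u_x`. What
remains is the commutator with `χ'` (`l2_weight_sum_le`). These estimates are proved by duality: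
each pairing is computed with a test function solving an explicit equation `∂_e P + κ P = m`
(`exists_dirDeriv_add_mul_eq`).

Letting `s → ±∞` kills `z` wherever the phase exceeds its maximum on the support of the commutator
(`ae_sum_eq_zero_of_lt`). A cut-off at the final time clears one side of a characteristic, and a
cut-off at the initial time clears the opposite side of another. If the time span exceeds `2π /
|c|`, these regions cover the rectangle, so `z = 0`. Then `u + u_x = 0` and the compact support in
`x` give `u = 0` (`PlaneSolution.ae_eq_zero`). -/

section

open scoped ContDiff

/-! ### Damped transport solved by averaging along half-lines -/

/-- The derivative of `φ` in the direction `e`. -/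
noncomputable def dirDeriv (e : ℝ × ℝ) (φ : ℝ × ℝ → ℝ) : ℝ × ℝ → ℝ := fun p => fderiv ℝ φ p e

/-- The average of `m` over the half-line `p - [0, ∞) e` with weight `exp (-κ r)`. -/
noncomputable def halfLineAverage (e : ℝ × ℝ) (κ : ℝ) (m : ℝ × ℝ → ℝ) : ℝ × ℝ → ℝ :=
  fun p => ∫ r in Ioi (0 : ℝ), Real.exp (-κ * r) * m (p - r • e)

lemma integrableOn_exp_neg_mul {κ : ℝ} (hκ : 0 < κ) :
    IntegrableOn (fun r : ℝ => Real.exp (-κ * r)) (Ioi 0) := by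
  simpa using integrableOn_exp_mul_Ioi (by linarith : -κ < 0) 0

lemma integral_exp_neg_mul {κ : ℝ} (hκ : 0 < κ) :
    ∫ r in Ioi (0 : ℝ), Real.exp (-κ * r) = κ⁻¹ := by
  rw [integral_exp_mul_Ioi (by linarith : -κ < 0) 0]
  simp

/-- The average is a one-dimensional convolution in `r`, evaluated at `0`, whose second factor `x ↦
m (p + x • e)` depends on the parameter `p`. For `p` near `p₀` these factors share a compact
support, so smoothness in the parameter applies. -/
lemma contDiff_halfLineAverage {e : ℝ × ℝ} (he : e ≠ 0) {κ : ℝ} (hκ : 0 < κ) {m : ℝ × ℝ → ℝ}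
    (hm : ContDiff ℝ ∞ m) (hc : HasCompactSupport m) : ContDiff ℝ ∞ (halfLineAverage e κ m) := by
  obtain ⟨R, hR⟩ := hc.isCompact.isBounded.subset_closedBall 0
  have he' : 0 < ‖e‖ := norm_pos_iff.2 he
  rw [contDiff_iff_contDiffAt]
  intro p₀
  let s : Set (ℝ × ℝ) := Metric.ball 0 (‖p₀‖ + 1)
  let k : Set ℝ := Metric.closedBall 0 ((R + ‖p₀‖ + 1) / ‖e‖)
  have key := contDiffOn_convolution_right_with_param_comp (𝕜 := ℝ) (n := ⊤) (μ := volume)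
    (ContinuousLinearMap.mul ℝ ℝ) (s := s) (v := fun _ : ℝ × ℝ => (0 : ℝ)) contDiffOn_const
    (f := (Ioi (0 : ℝ)).indicator fun r => Real.exp (-κ * r))
    (g := fun p x => m (p + x • e)) (k := k) Metric.isOpen_ball (isCompact_closedBall _ _)
    (by
      intro p x hp hx
      by_contra hne
      have h1 : p + x • e ∈ Metric.closedBall (0 : ℝ × ℝ) R := hR (subset_tsupport _ hne)
      rw [mem_closedBall_zero_iff] at h1
      rw [mem_ball_zero_iff] at hp
      apply hx
      rw [mem_closedBall_zero_iff, le_div_iff₀ he', ← norm_smul]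
      have : x • e = (p + x • e) - p := by abel
      rw [this]
      exact (norm_sub_le _ _).trans (by linarith))
    ((integrable_indicator_iff measurableSet_Ioi).2
      (integrableOn_exp_neg_mul hκ)).locallyIntegrable
    (by
      refine ContDiff.contDiffOn ?_
      exact hm.comp (contDiff_fst.add (contDiff_snd.smul contDiff_const)))
  have hp₀ : s ∈ nhds p₀ := Metric.isOpen_ball.mem_nhds (by simp)
  refine (key.contDiffAt hp₀).congr_of_eventuallyEq (Filter.Eventually.of_forall fun p => ?_)
  simp only [halfLineAverage, convolution_def, ContinuousLinearMap.mul_apply']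
  rw [← integral_indicator measurableSet_Ioi]
  congr 1
  ext r
  by_cases hr : r ∈ Ioi (0 : ℝ) <;> simp [hr, sub_eq_add_neg]

/-- Substituting `ρ = h - r` turns the average at `p + h • e` into `exp (-κ h) ∫_{-∞}^h exp (κ ρ) m
(p + ρ • e) dρ`. The identity is then the product rule and the fundamental theorem of calculus at `h
= 0`. -/
lemma dirDeriv_halfLineAverage {e : ℝ × ℝ} (he : e ≠ 0) {κ : ℝ} (hκ : 0 < κ) {m : ℝ × ℝ → ℝ}
    (hm : ContDiff ℝ ∞ m) (hc : HasCompactSupport m) (p : ℝ × ℝ) :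
    dirDeriv e (halfLineAverage e κ m) p + κ * halfLineAverage e κ m p = m p := by
  let F : ℝ → ℝ := fun ρ => Real.exp (κ * ρ) * m (p + ρ • e)
  have hFc : Continuous F := by
    have := hm.continuous
    fun_prop
  have hemb : Topology.IsClosedEmbedding (fun ρ : ℝ => p + ρ • e) :=
    (Homeomorph.addLeft p).isClosedEmbedding.comp (isClosedEmbedding_smul_left he)
  have hFs : HasCompactSupport F := (hc.comp_isClosedEmbedding hemb).mul_left
  have hFi : Integrable F := hFc.integrable_of_hasCompactSupport hFs
  have hline : ∀ h : ℝ, halfLineAverage e κ m (p + h • e)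
      = Real.exp (-κ * h) * ((∫ ρ in Iic (0 : ℝ), F ρ) + ∫ ρ in (0 : ℝ)..h, F ρ) := by
    intro h
    have h1 : (∫ ρ in Iic (0 : ℝ), F ρ) + ∫ ρ in (0 : ℝ)..h, F ρ = ∫ ρ in Iic h, F ρ := by
      rw [← intervalIntegral.integral_Iic_sub_Iic hFi.integrableOn hFi.integrableOn]
      ring
    rw [h1, integral_Iic_eq_integral_Iio, ← integral_indicator measurableSet_Iio,
      ← integral_const_mul, halfLineAverage, ← integral_indicator measurableSet_Ioi,
      ← integral_sub_left_eq_self _ volume h]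
    congr 1
    ext ρ
    by_cases hρ : ρ < h
    · rw [indicator_of_mem (by simpa using hρ), indicator_of_mem (by simpa using hρ),
        ← mul_assoc, ← Real.exp_add]
      congr 2
      · ring
      · rw [sub_smul]; abel
    · rw [indicator_of_notMem (by simpa using hρ), indicator_of_notMem (by simpa using hρ), mul_zero]
  have hd : HasDerivAt (fun h : ℝ => halfLineAverage e κ m (p + h • e))
      (-κ * halfLineAverage e κ m p + m p) 0 := by
    have h0 := hline 0
    simp only [zero_smul, add_zero, intervalIntegral.integral_same, mul_zero, Real.exp_zero,
      one_mul] at h0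
    have h2 : HasDerivAt (fun h : ℝ => ∫ ρ in (0 : ℝ)..h, F ρ) (F 0) 0 :=
      intervalIntegral.integral_hasDerivAt_right (hFc.intervalIntegrable _ _)
        (hFc.stronglyMeasurableAtFilter _ _) hFc.continuousAt
    have h3 : HasDerivAt (fun h : ℝ => Real.exp (-κ * h)) (-κ) 0 := by
      simpa using ((hasDerivAt_id (0 : ℝ)).const_mul (-κ)).exp
    have h4 := h3.mul (h2.const_add (∫ ρ in Iic (0 : ℝ), F ρ))
    refine (h4.congr_of_eventuallyEq (Filter.Eventually.of_forall fun h => hline h)).congr_deriv ?_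
    simp [h0, F]
  have hdiff : DifferentiableAt ℝ (halfLineAverage e κ m) (p + (0 : ℝ) • e) :=
    (contDiff_halfLineAverage he hκ hm hc).differentiable (by simp) _
  have hl : HasDerivAt (fun h : ℝ => p + h • e) e 0 := by
    simpa using ((hasDerivAt_id (0 : ℝ)).smul_const e).const_add p
  have hd' := hdiff.hasFDerivAt.comp_hasDerivAt 0 hl
  have := hd'.unique hd
  simp only [zero_smul, add_zero] at this
  rw [dirDeriv, this]
  ring

lemma halfLineAverage_ne_zero {e : ℝ × ℝ} {κ : ℝ} {m : ℝ × ℝ → ℝ} {p : ℝ × ℝ}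
    (h : halfLineAverage e κ m p ≠ 0) : ∃ r : ℝ, 0 ≤ r ∧ m (p - r • e) ≠ 0 := by
  by_contra! hcon
  apply h
  rw [halfLineAverage]
  refine (setIntegral_congr_fun measurableSet_Ioi fun r hr => ?_).trans (integral_zero _ _)
  simp [hcon r (le_of_lt hr)]

/-- The kernel `exp (-κ r)` has mass `κ⁻¹`. Cauchy–Schwarz along the half-line gives one factor
`κ⁻¹`; Tonelli and translation invariance give the other. -/
lemma lintegral_sq_halfLineAverage_le {e : ℝ × ℝ} {κ : ℝ} (hκ : 0 < κ)
    {m : ℝ × ℝ → ℝ} (hm : Continuous m) (hc : HasCompactSupport m) :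
    ∫⁻ p, ENNReal.ofReal (halfLineAverage e κ m p ^ 2)
      ≤ ENNReal.ofReal (κ⁻¹ ^ 2) * ∫⁻ p, ENNReal.ofReal (m p ^ 2) := by
  obtain ⟨B, hB⟩ := hc.exists_bound_of_continuous hm
  have hcm : ∀ p : ℝ × ℝ, Continuous fun r : ℝ => m (p - r • e) := fun p => by fun_prop
  have hexp := integrableOn_exp_neg_mul hκ
  have i1 : ∀ p, IntegrableOn (fun r : ℝ => Real.exp (-κ * r) * m (p - r • e)) (Ioi 0) :=
    fun p => hexp.mul_bdd (c := B) (hcm p).aestronglyMeasurable (Filter.Eventually.of_forall fun r => hB _)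
  have i2 : ∀ p, IntegrableOn (fun r : ℝ => Real.exp (-κ * r) * m (p - r • e) ^ 2) (Ioi 0) :=
    fun p => hexp.mul_bdd (c := B ^ 2) ((hcm p).pow 2).aestronglyMeasurable
      (Filter.Eventually.of_forall fun r => by
        rw [norm_pow]; exact pow_le_pow_left₀ (norm_nonneg _) (hB _) 2)
  have cs : ∀ p, halfLineAverage e κ m p ^ 2
      ≤ κ⁻¹ * ∫ r in Ioi (0 : ℝ), Real.exp (-κ * r) * m (p - r • e) ^ 2 := by
    intro p
    set A := halfLineAverage e κ m p with hA
    -- Cauchy–Schwarz as nonnegativity of a variance: `κ * A` is the mean of `m` for the probability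
    -- density `κ exp (-κ r)`.
    have h0 : 0 ≤ ∫ r in Ioi (0 : ℝ), Real.exp (-κ * r) * (m (p - r • e) - κ * A) ^ 2 :=
      integral_nonneg fun r => by positivity
    have h1 : ∫ r in Ioi (0 : ℝ), Real.exp (-κ * r) * (m (p - r • e) - κ * A) ^ 2
        = (∫ r in Ioi (0 : ℝ), Real.exp (-κ * r) * m (p - r • e) ^ 2)
          - 2 * κ * A * A + (κ * A) ^ 2 * κ⁻¹ := by
      rw [← integral_exp_neg_mul hκ, ← integral_const_mul]
      have i3 : IntegrableOn (fun r : ℝ => Real.exp (-κ * r) * m (p - r • e) ^ 2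
          - 2 * κ * A * (Real.exp (-κ * r) * m (p - r • e))) (Ioi 0) :=
        (i2 p).sub ((i1 p).const_mul _)
      nth_rewrite 3 [hA]
      rw [halfLineAverage, ← integral_const_mul, ← integral_sub (i2 p) ((i1 p).const_mul _),
        ← integral_add i3 (hexp.const_mul _)]
      congr 1
      ext r
      ring
    rw [h1] at h0
    have h2 : (κ * A) ^ 2 * κ⁻¹ = κ * A ^ 2 := by field_simp
    rw [h2] at h0
    rw [inv_mul_eq_div, le_div_iff₀ hκ]
    nlinarith
  calc ∫⁻ p, ENNReal.ofReal (halfLineAverage e κ m p ^ 2)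
      ≤ ∫⁻ p, ENNReal.ofReal κ⁻¹ * ∫⁻ r in Ioi (0 : ℝ),
          ENNReal.ofReal (Real.exp (-κ * r)) * ENNReal.ofReal (m (p - r • e) ^ 2) := by
        refine lintegral_mono fun p => ?_
        refine (ENNReal.ofReal_le_ofReal (cs p)).trans ?_
        rw [ENNReal.ofReal_mul (inv_nonneg.2 hκ.le), ofReal_integral_eq_lintegral_ofReal (i2 p)
          (Filter.Eventually.of_forall fun r => by positivity)]
        refine le_of_eq ?_
        congr 2
        ext r
        rw [ENNReal.ofReal_mul (Real.exp_pos _).le]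
    _ = ENNReal.ofReal κ⁻¹ * ∫⁻ r in Ioi (0 : ℝ), ∫⁻ p : ℝ × ℝ,
          ENNReal.ofReal (Real.exp (-κ * r)) * ENNReal.ofReal (m (p - r • e) ^ 2) := by
        rw [lintegral_const_mul' _ _ ENNReal.ofReal_ne_top, lintegral_lintegral_swap]
        refine Measurable.aemeasurable ?_
        have hm' := hm.measurable
        simp only [Function.uncurry_def]
        fun_prop
    _ = ENNReal.ofReal κ⁻¹ * ∫⁻ r in Ioi (0 : ℝ), ENNReal.ofReal (Real.exp (-κ * r)) *
          ∫⁻ p, ENNReal.ofReal (m p ^ 2) := by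
        congr 2
        ext r
        rw [lintegral_const_mul' _ _ ENNReal.ofReal_ne_top,
          lintegral_sub_right_eq_self (fun p => ENNReal.ofReal (m p ^ 2)) (r • e)]
    _ = ENNReal.ofReal (κ⁻¹ ^ 2) * ∫⁻ p, ENNReal.ofReal (m p ^ 2) := by
        rw [lintegral_mul_const _ (by fun_prop), ← ofReal_integral_eq_lintegral_ofReal hexp
          (Filter.Eventually.of_forall fun r => by positivity), integral_exp_neg_mul hκ,
          ← mul_assoc, ← ENNReal.ofReal_mul (inv_nonneg.2 hκ.le), sq]

/-! ### The `L²` norm on the plane and duality -/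

/-- The `L²` norm over the plane. -/
noncomputable def l2 (f : ℝ × ℝ → ℝ) : ℝ := (eLpNorm f 2 volume).toReal

lemma l2_nonneg (f : ℝ × ℝ → ℝ) : 0 ≤ l2 f := ENNReal.toReal_nonneg

lemma l2_eq_norm {f : ℝ × ℝ → ℝ} (hf : MemLp f 2 volume) : l2 f = ‖hf.toLp f‖ :=
  (Lp.norm_toLp f hf).symm

lemma inner_toLp {f g : ℝ × ℝ → ℝ} (hf : MemLp f 2 volume) (hg : MemLp g 2 volume) :
    inner ℝ (hf.toLp f) (hg.toLp g) = ∫ p, f p * g p := by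
  rw [L2.inner_def]
  refine integral_congr_ae ?_
  filter_upwards [hf.coeFn_toLp, hg.coeFn_toLp] with p h1 h2
  rw [h1, h2]
  simp [mul_comm]

lemma l2_sq {f : ℝ × ℝ → ℝ} (hf : MemLp f 2 volume) : l2 f ^ 2 = ∫ p, f p ^ 2 := by
  rw [l2_eq_norm hf, ← real_inner_self_eq_norm_sq, inner_toLp hf hf]
  simp [sq]

lemma abs_integral_mul_le_l2 {f g : ℝ × ℝ → ℝ} (hf : MemLp f 2 volume) (hg : MemLp g 2 volume) :
    |∫ p, f p * g p| ≤ l2 f * l2 g := by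
  rw [l2_eq_norm hf, l2_eq_norm hg, ← inner_toLp hf hg]
  exact abs_real_inner_le_norm _ _

lemma l2_add_le {f g : ℝ × ℝ → ℝ} (hf : MemLp f 2 volume) (hg : MemLp g 2 volume) :
    l2 (fun p => f p + g p) ≤ l2 f + l2 g := by
  rw [l2, l2, l2, ← ENNReal.toReal_add hf.2.ne hg.2.ne]
  exact ENNReal.toReal_mono (ENNReal.add_ne_top.2 ⟨hf.2.ne, hg.2.ne⟩)
    (eLpNorm_add_le hf.1 hg.1 (by norm_num))

lemma l2_le_mul_l2 {f g : ℝ × ℝ → ℝ} (hg : MemLp g 2 volume) {C : ℝ} (hC : 0 ≤ C)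
    (h : ∀ᵐ p, |f p| ≤ C * |g p|) : l2 f ≤ C * l2 g := by
  have := eLpNorm_le_mul_eLpNorm_of_ae_le_mul (p := 2) (μ := volume) (f := f) (g := g) (c := C) h
  rw [l2, l2, ← ENNReal.toReal_ofReal hC, ← ENNReal.toReal_mul]
  exact ENNReal.toReal_mono (ENNReal.mul_ne_top ENNReal.ofReal_ne_top hg.2.ne) this

lemma ae_eq_zero_of_l2_eq_zero {f : ℝ × ℝ → ℝ} (hf : MemLp f 2 volume) (h : l2 f = 0) :
    ∀ᵐ p, f p = 0 := by
  rw [l2, ENNReal.toReal_eq_zero_iff, or_iff_left hf.2.ne,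
    eLpNorm_eq_zero_iff hf.1 (by norm_num)] at h
  exact h

lemma memLp_two_of_contDiff {m : ℝ × ℝ → ℝ} (hm : ContDiff ℝ ∞ m) (hc : HasCompactSupport m) :
    MemLp m 2 volume :=
  hm.continuous.memLp_of_hasCompactSupport hc

/-- An `L²` bound follows from the bound on the pairings with test functions. -/
lemma l2_le_of_forall_test {F : ℝ × ℝ → ℝ} (hF : MemLp F 2 volume) {B : ℝ}
    (h : ∀ m : ℝ × ℝ → ℝ, ContDiff ℝ ∞ m → HasCompactSupport m → |∫ p, F p * m p| ≤ B * l2 m) :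
    l2 F ≤ B := by
  let S : Set (Lp ℝ 2 (volume : Measure (ℝ × ℝ))) := {f | |inner ℝ (hF.toLp F) f| ≤ B * ‖f‖}
  have hS : IsClosed S := isClosed_le (by fun_prop) (by fun_prop)
  have hd := Lp.dense_hasCompactSupport_contDiff (F := ℝ) (μ := (volume : Measure (ℝ × ℝ)))
    (p := 2) (by norm_num)
  have hsub : {f : Lp ℝ 2 (volume : Measure (ℝ × ℝ)) | ∃ g : ℝ × ℝ → ℝ,
      f =ᵐ[volume] g ∧ HasCompactSupport g ∧ ContDiff ℝ ∞ g} ⊆ S := by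
    rintro f ⟨g, hfg, hgc, hg⟩
    have hgm := memLp_two_of_contDiff hg hgc
    have : f = hgm.toLp g := Lp.ext (hfg.trans hgm.coeFn_toLp.symm)
    have h' := h g hg hgc
    rw [l2_eq_norm hgm, ← inner_toLp hF hgm] at h'
    rw [this]
    exact h'
  have huniv : S = univ := by
    rw [← univ_subset_iff, ← hd.closure_eq]
    exact hS.closure_subset_iff.2 hsub
  have hmem : hF.toLp F ∈ S := huniv ▸ mem_univ _
  have hmem' : |inner ℝ (hF.toLp F) (hF.toLp F)| ≤ B * ‖hF.toLp F‖ := hmem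
  rw [real_inner_self_eq_norm_sq, abs_of_nonneg (sq_nonneg _), ← l2_eq_norm hF] at hmem'
  rcases (l2_nonneg F).eq_or_lt with h0 | h0
  · rw [← h0] at hmem' ⊢
    -- The sign of `B` is not given. A negative `B` would force every test function to have norm
    -- zero, which a bump function refutes.
    by_contra! hB
    have hz : ∀ m : ℝ × ℝ → ℝ, ContDiff ℝ ∞ m → HasCompactSupport m → l2 m ≤ 0 := by
      intro m hm hc
      have := (abs_nonneg _).trans (h m hm hc)
      by_contra! hlt
      nlinarith
    let b : ContDiffBump (0 : ℝ × ℝ) := ⟨1, 2, one_pos, one_lt_two⟩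
    have hb := hz b b.contDiff b.hasCompactSupport
    have hb0 := ae_eq_zero_of_l2_eq_zero (memLp_two_of_contDiff b.contDiff b.hasCompactSupport)
      (le_antisymm hb (l2_nonneg _))
    have := (Continuous.ae_eq_iff_eq volume b.continuous continuous_const).1 hb0
    have h1 : b 0 = 1 := b.one_of_mem_closedBall (by simp [b])
    rw [this] at h1
    norm_num at h1
  · nlinarith

/-- In the duality bound it suffices to use test functions supported away from the set `ℓ ≤ 0`
where `F` vanishes. -/
lemma l2_le_of_forall_test_pos {F ℓ : ℝ × ℝ → ℝ} (hF : MemLp F 2 volume) (hℓ : ContDiff ℝ ∞ ℓ)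
    (hFℓ : ∀ p, ℓ p ≤ 0 → F p = 0) {B : ℝ} (hB : 0 ≤ B)
    (h : ∀ m : ℝ × ℝ → ℝ, ContDiff ℝ ∞ m → HasCompactSupport m →
      (∃ ε > 0, ∀ p, m p ≠ 0 → ε ≤ ℓ p) → |∫ p, F p * m p| ≤ B * l2 m) :
    l2 F ≤ B := by
  refine l2_le_of_forall_test hF fun m hm hc => ?_
  have hmm := memLp_two_of_contDiff hm hc
  -- For `n > 0` this vanishes where `ℓ ≤ 1 / n` and equals `1` where `ℓ ≥ 2 / n`. It therefore
  -- tends to `1` on `0 < ℓ`, and `F` vanishes elsewhere.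
  let β : ℕ → ℝ × ℝ → ℝ := fun n p => Real.smoothTransition (n * ℓ p - 1)
  have hβ : ∀ n, ContDiff ℝ ∞ (β n) := fun n =>
    Real.smoothTransition.contDiff.comp ((contDiff_const.mul hℓ).sub contDiff_const)
  have hβ1 : ∀ n p, |β n p| ≤ 1 := fun n p => by
    rw [abs_of_nonneg (Real.smoothTransition.nonneg _)]
    exact Real.smoothTransition.le_one _
  have hbound : ∀ n : ℕ, |∫ p, F p * (β n p * m p)| ≤ B * l2 m := by
    intro n
    refine (h _ ((hβ n).mul hm) hc.mul_left ?_).trans ?_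
    · refine ⟨1 / (n + 1), by positivity, fun p hp => ?_⟩
      by_contra! hlt
      refine hp ?_
      have : β n p = 0 := by
        refine Real.smoothTransition.zero_of_nonpos ?_
        rw [lt_div_iff₀ (by positivity)] at hlt
        by_cases hl : 0 ≤ ℓ p
        · nlinarith
        · have : (n : ℝ) * ℓ p ≤ 0 := mul_nonpos_of_nonneg_of_nonpos (by positivity) (by linarith)
          linarith
      rw [this, zero_mul]
    · refine mul_le_mul_of_nonneg_left ?_ hB
      have := l2_le_mul_l2 (f := fun p => β n p * m p) hmm zero_le_one
        (Filter.Eventually.of_forall fun p => by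
          rw [abs_mul]
          exact mul_le_mul_of_nonneg_right (hβ1 n p) (abs_nonneg _))
      linarith
  have hlim : Filter.Tendsto (fun n => ∫ p, F p * (β n p * m p)) Filter.atTop
      (nhds (∫ p, F p * m p)) := by
    have hint : Integrable (fun p => F p * m p) := hF.integrable_mul hmm
    refine tendsto_integral_of_dominated_convergence (fun p => ‖F p * m p‖) (fun n => ?_)
      hint.norm (fun n => Filter.Eventually.of_forall fun p => ?_)
      (Filter.Eventually.of_forall fun p => ?_)
    · exact hF.1.mul ((hβ n).continuous.mul hm.continuous).aestronglyMeasurable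
    · rw [norm_mul, norm_mul, norm_mul]
      have := hβ1 n p
      rw [← Real.norm_eq_abs] at this
      exact mul_le_mul_of_nonneg_left
        (mul_le_of_le_one_left (norm_nonneg _) this) (norm_nonneg _)
    · by_cases hp : ℓ p ≤ 0
      · simp [hFℓ p hp]
      · push Not at hp
        refine tendsto_const_nhds.congr' ?_
        obtain ⟨N, hN⟩ := exists_nat_gt (2 / ℓ p)
        filter_upwards [Filter.eventually_ge_atTop N] with n hn
        have : β n p = 1 := by
          refine Real.smoothTransition.one_of_one_le ?_
          rw [div_lt_iff₀ hp] at hN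
          have : (N : ℝ) ≤ n := by exact_mod_cast hn
          nlinarith
        rw [this, one_mul]
  exact le_of_tendsto hlim.abs (Filter.Eventually.of_forall hbound)

/-! ### Compactly supported solutions of the damped transport equation on a ball -/

lemma l2_halfLineAverage_mul_le {e : ℝ × ℝ} {κ : ℝ} (hκ : 0 < κ) {m β : ℝ × ℝ → ℝ}
    (hm : ContDiff ℝ ∞ m) (hc : HasCompactSupport m)
    (hβ : ∀ p, |β p| ≤ 1) (hP : MemLp (fun p => β p * halfLineAverage e κ m p) 2 volume) :
    l2 (fun p => β p * halfLineAverage e κ m p) ≤ κ⁻¹ * l2 m := by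
  have hmm := memLp_two_of_contDiff hm hc
  refine le_of_sq_le_sq ?_ (mul_nonneg (inv_nonneg.2 hκ.le) (l2_nonneg _))
  rw [mul_pow, l2_sq hP, l2_sq hmm]
  have hfin : ∫⁻ p, ENNReal.ofReal (m p ^ 2) ≠ ⊤ := by
    rw [← ofReal_integral_eq_lintegral_ofReal hmm.integrable_sq
      (Filter.Eventually.of_forall fun p => sq_nonneg _)]
    exact ENNReal.ofReal_ne_top
  rw [integral_eq_lintegral_of_nonneg_ae (Filter.Eventually.of_forall fun p => sq_nonneg _)
    (hP.1.pow 2), integral_eq_lintegral_of_nonneg_ae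
    (Filter.Eventually.of_forall fun p => sq_nonneg _) (hmm.1.pow 2),
    ← ENNReal.toReal_ofReal (sq_nonneg κ⁻¹), ← ENNReal.toReal_mul]
  refine ENNReal.toReal_mono (ENNReal.mul_ne_top ENNReal.ofReal_ne_top hfin) ?_
  refine (lintegral_mono fun p => ENNReal.ofReal_le_ofReal ?_).trans
    (lintegral_sq_halfLineAverage_le (e := e) hκ hm.continuous hc)
  rw [mul_pow]
  refine mul_le_of_le_one_left (sq_nonneg _) ?_
  rw [← sq_abs]
  exact pow_le_one₀ (abs_nonneg _) (hβ p)

lemma dirDeriv_congr {f g : ℝ × ℝ → ℝ} {p : ℝ × ℝ} (h : f =ᶠ[nhds p] g) (e : ℝ × ℝ) :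
    dirDeriv e f p = dirDeriv e g p := by
  rw [dirDeriv, dirDeriv, h.fderiv_eq]

/-- On a ball, `∂ₑ P + κ P = m` has a compactly supported smooth solution with `‖P‖ ≤ ‖m‖ / |κ|`,
supported downstream of `m`. -/
lemma exists_dirDeriv_add_mul_eq {e : ℝ × ℝ} (he : e ≠ 0) {κ : ℝ} (hκ : κ ≠ 0) (R : ℝ)
    {m : ℝ × ℝ → ℝ} (hm : ContDiff ℝ ∞ m) (hc : HasCompactSupport m) :
    ∃ P : ℝ × ℝ → ℝ, ContDiff ℝ ∞ P ∧ HasCompactSupport P ∧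
      (∀ p ∈ Metric.ball (0 : ℝ × ℝ) R, dirDeriv e P p + κ * P p = m p) ∧
      (∀ p, P p ≠ 0 → ∃ r : ℝ, 0 ≤ κ * r ∧ m (p - r • e) ≠ 0) ∧ l2 P ≤ |κ|⁻¹ * l2 m := by
  have main : ∀ {e : ℝ × ℝ}, e ≠ 0 → ∀ {κ : ℝ}, 0 < κ → ∀ {m : ℝ × ℝ → ℝ}, ContDiff ℝ ∞ m →
      HasCompactSupport m → ∃ P : ℝ × ℝ → ℝ, ContDiff ℝ ∞ P ∧ HasCompactSupport P ∧
      (∀ p ∈ Metric.ball (0 : ℝ × ℝ) R, dirDeriv e P p + κ * P p = m p) ∧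
      (∀ p, P p ≠ 0 → ∃ r : ℝ, 0 ≤ r ∧ m (p - r • e) ≠ 0) ∧ l2 P ≤ κ⁻¹ * l2 m := by
    intro e he κ hκ m hm hc
    -- The average can have an unbounded tail downstream; the bump removes it without changing the
    -- equation on the ball. The absolute value covers negative `R`.
    let b : ContDiffBump (0 : ℝ × ℝ) := ⟨|R| + 1, |R| + 2, by positivity, by linarith⟩
    have hP := contDiff_halfLineAverage he hκ hm hc
    have hcs : HasCompactSupport fun p => b p * halfLineAverage e κ m p :=
      b.hasCompactSupport.mul_right
    have hsm : ContDiff ℝ ∞ fun p => b p * halfLineAverage e κ m p := b.contDiff.mul hP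
    refine ⟨fun p => b p * halfLineAverage e κ m p, hsm, hcs, fun p hp => ?_, fun p hp => ?_,
      l2_halfLineAverage_mul_le hκ hm hc (fun p => ?_) (memLp_two_of_contDiff hsm hcs)⟩
    · beta_reduce
      have hp' : p ∈ Metric.ball (0 : ℝ × ℝ) (|R| + 1) :=
        Metric.ball_subset_ball (by linarith [le_abs_self R]) hp
      have hev : (fun p => b p * halfLineAverage e κ m p) =ᶠ[nhds p] halfLineAverage e κ m := by
        filter_upwards [Metric.isOpen_ball.mem_nhds hp'] with x hx
        rw [b.one_of_mem_closedBall (Metric.ball_subset_closedBall hx), one_mul]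
      rw [dirDeriv_congr hev, show b p * _ = _ from hev.eq_of_nhds,
        dirDeriv_halfLineAverage he hκ hm hc]
    · exact halfLineAverage_ne_zero (right_ne_zero_of_mul hp)
    · rw [abs_of_nonneg b.nonneg]
      exact b.le_one
  rcases hκ.lt_or_gt with h | h
  -- For `κ < 0` the signs of `e`, `κ` and `m` are all reversed: the same equation, with the average
  -- taken over the opposite half-line.
  · obtain ⟨P, h1, h2, h3, h4, h5⟩ := main (neg_ne_zero.2 he) (neg_pos.2 h) hm.neg hc.neg
    refine ⟨P, h1, h2, fun p hp => ?_, fun p hp => ?_, ?_⟩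
    · have := h3 p hp
      simp only [dirDeriv, map_neg] at this ⊢
      linarith
    · obtain ⟨r, hr, hr'⟩ := h4 p hp
      refine ⟨-r, by nlinarith, ?_⟩
      simpa using hr'
    · rw [abs_of_neg h]
      refine h5.trans (le_of_eq ?_)
      congr 1
      rw [l2, l2, ← eLpNorm_neg m]
      rfl
  · obtain ⟨P, h1, h2, h3, h4, h5⟩ := main he h hm hc
    refine ⟨P, h1, h2, h3, fun p hp => ?_, ?_⟩
    · obtain ⟨r, hr, hr'⟩ := h4 p hp
      exact ⟨r, by positivity, hr'⟩
    · rwa [abs_of_pos h]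

/-! ### Calculus of directional derivatives -/

lemma dirDeriv_eq_of_hasDerivAt {f : ℝ × ℝ → ℝ} {p e : ℝ × ℝ} {w : ℝ}
    (hf : DifferentiableAt ℝ f p) (h : HasDerivAt (fun r : ℝ => f (p + r • e)) w 0) :
    dirDeriv e f p = w := by
  have hl : HasDerivAt (fun r : ℝ => p + r • e) e 0 := by
    simpa using ((hasDerivAt_id (0 : ℝ)).smul_const e).const_add p
  have hf' : DifferentiableAt ℝ f (p + (0 : ℝ) • e) := by simpa using hf
  have := (hf'.hasFDerivAt.comp_hasDerivAt 0 hl).unique h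
  simpa [dirDeriv] using this

lemma contDiff_dirDeriv {f : ℝ × ℝ → ℝ} (hf : ContDiff ℝ ∞ f) (e : ℝ × ℝ) :
    ContDiff ℝ ∞ (dirDeriv e f) :=
  (hf.fderiv_right (m := ∞) (by simp)).clm_apply contDiff_const

lemma hasCompactSupport_dirDeriv {f : ℝ × ℝ → ℝ} (hf : HasCompactSupport f) (e : ℝ × ℝ) :
    HasCompactSupport (dirDeriv e f) :=
  hf.fderiv_apply ℝ e

lemma dirDeriv_add {f g : ℝ × ℝ → ℝ} (hf : ContDiff ℝ ∞ f) (hg : ContDiff ℝ ∞ g) (e p : ℝ × ℝ) :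
    dirDeriv e (fun x => f x + g x) p = dirDeriv e f p + dirDeriv e g p := by
  simp only [dirDeriv]
  rw [fderiv_fun_add (hf.differentiable (by simp) p) (hg.differentiable (by simp) p)]
  rfl

lemma dirDeriv_mul {f g : ℝ × ℝ → ℝ} (hf : ContDiff ℝ ∞ f) (hg : ContDiff ℝ ∞ g) (e p : ℝ × ℝ) :
    dirDeriv e (fun x => f x * g x) p = f p * dirDeriv e g p + dirDeriv e f p * g p := by
  simp only [dirDeriv]
  rw [fderiv_fun_mul (hf.differentiable (by simp) p) (hg.differentiable (by simp) p)]
  simp [mul_comm]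

lemma dirDeriv_dir (f : ℝ × ℝ → ℝ) (c : ℝ) (p : ℝ × ℝ) :
    dirDeriv (c, 1) f p = dirDeriv (0, 1) f p + c * dirDeriv (1, 0) f p := by
  have : ((c, 1) : ℝ × ℝ) = (0, 1) + c • (1, 0) := by simp
  simp only [dirDeriv]
  rw [this, map_add, map_smul, smul_eq_mul]

lemma dirDeriv_comm {f : ℝ × ℝ → ℝ} (hf : ContDiff ℝ ∞ f) (e e' p : ℝ × ℝ) :
    dirDeriv e (dirDeriv e' f) p = dirDeriv e' (dirDeriv e f) p := by
  have hd : DifferentiableAt ℝ (fderiv ℝ f) p :=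
    (hf.fderiv_right (m := ∞) (by simp)).differentiable (by simp) p
  have h : ∀ v w : ℝ × ℝ, dirDeriv v (dirDeriv w f) p = fderiv ℝ (fderiv ℝ f) p v w := by
    intro v w
    have h1 : HasFDerivAt (dirDeriv w f) ((fderiv ℝ (fderiv ℝ f) p).flip w) p :=
      hd.hasFDerivAt.clm_apply (hasFDerivAt_const w p) |>.congr_fderiv (by ext <;> simp)
    rw [dirDeriv, h1.fderiv]
    rfl
  rw [h, h]
  exact ((contDiff_infty.1 hf 2).contDiffAt.isSymmSndFDerivAt (by simp)) e e'

lemma integral_linear_comb {f₁ f₂ f₃ f₄ f₅ : ℝ × ℝ → ℝ} (h₁ : Integrable f₁) (h₂ : Integrable f₂)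
    (h₃ : Integrable f₃) (h₄ : Integrable f₄) (h₅ : Integrable f₅) {a₁ a₂ a₃ a₄ a₅ : ℝ} :
    ∫ p, (a₁ * f₁ p + a₂ * f₂ p + a₃ * f₃ p + a₄ * f₄ p + a₅ * f₅ p)
      = a₁ * (∫ p, f₁ p) + a₂ * (∫ p, f₂ p) + a₃ * (∫ p, f₃ p) + a₄ * (∫ p, f₄ p)
        + a₅ * ∫ p, f₅ p := by
  have k₁ := h₁.const_mul a₁
  have k₂ := k₁.add (h₂.const_mul a₂)
  have k₃ := k₂.add (h₃.const_mul a₃)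
  have k₄ := k₃.add (h₄.const_mul a₄)
  have := integral_add k₄ (h₅.const_mul a₅)
  have := integral_add k₃ (h₄.const_mul a₄)
  have := integral_add k₂ (h₃.const_mul a₃)
  have := integral_add k₁ (h₂.const_mul a₂)
  simp only [Pi.add_apply, integral_const_mul] at *
  linarith

/-! ### Solutions on the plane, Carleman weights and the factorized equation -/

/-- The data of a weak solution on the strip, cut off so that it is supported in a rectangle. -/
structure PlaneSolution (c T a b M : ℝ) (q u v : ℝ × ℝ → ℝ) : Prop where
  memLp_u : MemLp u 2 volume
  memLp_v : MemLp v 2 volume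
  u_eq_zero : ∀ p, p ∉ Ioc a b ×ˢ Ioo 0 T → u p = 0
  v_eq_zero : ∀ p, p ∉ Ioc a b ×ˢ Ioo 0 T → v p = 0
  measurable_q : AEStronglyMeasurable q volume
  q_le : ∀ᵐ p, |q p| ≤ M
  weak_dx : ∀ φ : ℝ × ℝ → ℝ, ContDiff ℝ ∞ φ → HasCompactSupport φ →
    ∫ p, u p * dirDeriv (1, 0) φ p = - ∫ p, v p * φ p
  weak_eq : ∀ φ : ℝ × ℝ → ℝ, ContDiff ℝ ∞ φ → HasCompactSupport φ →
    (∃ ε > 0, ∀ p, φ p ≠ 0 → ε ≤ p.2 ∧ p.2 ≤ T - ε) →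
    ∫ p, (- (u p * dirDeriv (0, 1) φ p) + u p * dirDeriv (0, 1) (dirDeriv (1, 0) (dirDeriv (1, 0) φ)) p
      + c * (u p * dirDeriv (1, 0) (dirDeriv (1, 0) (dirDeriv (1, 0) φ)) p) + q p * v p * φ p) = 0

/-- The weight `χ(t) exp (s (x - c t) + μ t)`. -/
noncomputable def weight (c s μ : ℝ) (χ : ℝ → ℝ) : ℝ × ℝ → ℝ :=
  fun p => χ p.2 * Real.exp (s * (p.1 - c * p.2) + μ * p.2)

lemma contDiff_weight (c s μ : ℝ) {χ : ℝ → ℝ} (hχ : ContDiff ℝ ∞ χ) :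
    ContDiff ℝ ∞ (weight c s μ χ) := by
  refine (hχ.comp contDiff_snd).mul (Real.contDiff_exp.comp ?_)
  fun_prop

lemma dirDeriv_weight_space (c s μ : ℝ) {χ : ℝ → ℝ} (hχ : ContDiff ℝ ∞ χ) (p : ℝ × ℝ) :
    dirDeriv (1, 0) (weight c s μ χ) p = s * weight c s μ χ p := by
  refine dirDeriv_eq_of_hasDerivAt ((contDiff_weight c s μ hχ).differentiable (by simp) p) ?_
  have h1 : HasDerivAt (fun r : ℝ => s * (p.1 + r - c * p.2) + μ * p.2) s 0 := by
    simpa using ((((hasDerivAt_id (0 : ℝ)).const_add p.1).sub_const (c * p.2)).const_mul s).add_const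
      (μ * p.2)
  have h2 := (h1.exp).const_mul (χ p.2)
  refine (h2.congr_of_eventuallyEq (Filter.Eventually.of_forall fun r => ?_)).congr_deriv ?_
  · simp [weight]
  · simp [weight]; ring

/-- The phase `x - c t` is constant in the direction `(c, 1)`, so `s` does not appear on the right.
This is what lets `s` grow while `μ` stays fixed. -/
lemma dirDeriv_weight_transport (c s μ : ℝ) {χ : ℝ → ℝ} (hχ : ContDiff ℝ ∞ χ) (p : ℝ × ℝ) :
    dirDeriv (c, 1) (weight c s μ χ) p = weight c s μ (deriv χ) p + μ * weight c s μ χ p := by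
  refine dirDeriv_eq_of_hasDerivAt ((contDiff_weight c s μ hχ).differentiable (by simp) p) ?_
  have h0 : HasDerivAt (fun r : ℝ => p.2 + r) 1 0 := (hasDerivAt_id (0 : ℝ)).const_add p.2
  have h1 : HasDerivAt (fun r : ℝ => s * (p.1 - c * p.2) + μ * (p.2 + r)) μ 0 := by
    simpa using (h0.const_mul μ).const_add (s * (p.1 - c * p.2))
  have h3 : HasDerivAt χ (deriv χ (p.2 + 0)) (p.2 + 0) :=
    (hχ.differentiable (by simp) _).hasDerivAt
  have h2 := (h3.comp 0 h0).mul h1.exp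
  refine (h2.congr_of_eventuallyEq (Filter.Eventually.of_forall fun r => ?_)).congr_deriv ?_
  · simp only [weight, Prod.fst_add, Prod.snd_add, Prod.smul_mk, smul_eq_mul, mul_one, Pi.mul_apply,
      Function.comp]
    congr 2
    ring
  · simp [weight]; ring

namespace PlaneSolution

variable {c T a b M : ℝ} {q u v : ℝ × ℝ → ℝ}

/-- The exponential weights are unbounded on the plane, but bounded on the rectangle that carries
`w`. -/
lemma memLp_continuous_mul {w g : ℝ × ℝ → ℝ} (hw : MemLp w 2 volume)
    (h0 : ∀ p, p ∉ Ioc a b ×ˢ Ioo 0 T → w p = 0) (hg : Continuous g) :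
    MemLp (fun p => g p * w p) 2 volume := by
  have hK : IsCompact (Icc a b ×ˢ Icc 0 T) := isCompact_Icc.prod isCompact_Icc
  obtain ⟨C, hC⟩ := hK.exists_bound_of_continuousOn hg.continuousOn
  refine hw.of_le_mul (c := C) (hg.aestronglyMeasurable.mul hw.1)
    (Filter.Eventually.of_forall fun p => ?_)
  by_cases hp : p ∈ Ioc a b ×ˢ Ioo 0 T
  · rw [norm_mul]
    exact mul_le_mul_of_nonneg_right
      (hC p ⟨Ioc_subset_Icc_self hp.1, Ioo_subset_Icc_self hp.2⟩) (norm_nonneg _)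
  · simp [h0 p hp]

section
variable (S : PlaneSolution c T a b M q u v)
include S

lemma sum_eq_zero (p : ℝ × ℝ) (hp : p ∉ Ioc a b ×ˢ Ioo 0 T) : u p + v p = 0 := by
  rw [S.u_eq_zero p hp, S.v_eq_zero p hp, add_zero]

lemma memLp_sum : MemLp (fun p => u p + v p) 2 volume := S.memLp_u.add S.memLp_v

lemma memLp_coef_mul {w : ℝ × ℝ → ℝ} (hw : MemLp w 2 volume) :
    MemLp (fun p => (q p - c) * w p) 2 volume := by
  refine hw.of_le_mul (c := M + |c|) ((S.measurable_q.sub aestronglyMeasurable_const).mul hw.1) ?_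
  filter_upwards [S.q_le] with p hp
  rw [norm_mul]
  refine mul_le_mul_of_nonneg_right ?_ (norm_nonneg _)
  exact (norm_sub_le _ _).trans (add_le_add hp le_rfl)

/-- The factorized equation for `u + uₓ`. -/
lemma integral_sum_mul_transport {φ : ℝ × ℝ → ℝ} (hφ : ContDiff ℝ ∞ φ) (hc : HasCompactSupport φ)
    (ht : ∃ ε > 0, ∀ p, φ p ≠ 0 → ε ≤ p.2 ∧ p.2 ≤ T - ε) :
    ∫ p, (u p + v p) * dirDeriv (c, 1) (fun x => φ x + dirDeriv (1, 0) φ x) p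
      = ∫ p, (q p - c) * v p * φ p := by
  have hx := contDiff_dirDeriv hφ (1, 0)
  have hxc := hasCompactSupport_dirDeriv hc (1, 0)
  have hρ : ContDiff ℝ ∞ (dirDeriv (c, 1) fun x => φ x + dirDeriv (1, 0) φ x) :=
    contDiff_dirDeriv (hφ.add hx) _
  have hρc : HasCompactSupport (dirDeriv (c, 1) fun x => φ x + dirDeriv (1, 0) φ x) :=
    hasCompactSupport_dirDeriv (hc.add hxc) _
  -- With `D = ∂_t + c ∂_x` and `ρ = D (φ + φ_x)`, this reads `ρ_x = ρ - D (φ - φ_xx)`. Since `∫ v ρ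
  -- = -∫ u ρ_x`, pairing `u + v` with `ρ` leaves `∫ u D (φ - φ_xx)`, which the weak equation
  -- evaluates.
  have key : ∀ p, dirDeriv (1, 0) (dirDeriv (c, 1) fun x => φ x + dirDeriv (1, 0) φ x) p
      = dirDeriv (c, 1) (fun x => φ x + dirDeriv (1, 0) φ x) p
        - (dirDeriv (0, 1) φ p - dirDeriv (0, 1) (dirDeriv (1, 0) (dirDeriv (1, 0) φ)) p
          - c * dirDeriv (1, 0) (dirDeriv (1, 0) (dirDeriv (1, 0) φ)) p
          + c * dirDeriv (1, 0) φ p) := by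
    intro p
    rw [← dirDeriv_comm (hφ.add hx) (c, 1)]
    have h1 : (dirDeriv (1, 0) fun x => φ x + dirDeriv (1, 0) φ x)
        = fun x => dirDeriv (1, 0) φ x + dirDeriv (1, 0) (dirDeriv (1, 0) φ) x :=
      funext fun x => dirDeriv_add hφ hx _ x
    rw [h1, dirDeriv_add hx (contDiff_dirDeriv hx _), dirDeriv_add hφ hx,
      dirDeriv_dir φ, dirDeriv_dir (dirDeriv (1, 0) (dirDeriv (1, 0) φ))]
    ring
  have int : ∀ {w m : ℝ × ℝ → ℝ}, MemLp w 2 volume → ContDiff ℝ ∞ m → HasCompactSupport m →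
      Integrable fun p => w p * m p := fun hw hm hmc =>
    hw.integrable_mul (memLp_two_of_contDiff hm hmc)
  have e1 := S.weak_eq φ hφ hc ht
  have e2 := S.weak_dx φ hφ hc
  have e3 := S.weak_dx _ hρ hρc
  have hq : Integrable fun p => q p * v p * φ p := by
    have h1 := int (S.memLp_coef_mul S.memLp_v) hφ hc
    have h2 := (int S.memLp_v hφ hc).const_mul c
    refine (h1.add h2).congr (Filter.Eventually.of_forall fun p => ?_)
    simp only [Pi.add_apply]
    ring
  have i1 := int S.memLp_u (contDiff_dirDeriv hφ (0, 1)) (hasCompactSupport_dirDeriv hc _)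
  have hxx := contDiff_dirDeriv hx (1, 0)
  have hxxc := hasCompactSupport_dirDeriv hxc (1, 0)
  have i2 := int S.memLp_u (contDiff_dirDeriv hxx (0, 1)) (hasCompactSupport_dirDeriv hxxc _)
  have i3 := int S.memLp_u (contDiff_dirDeriv hxx (1, 0)) (hasCompactSupport_dirDeriv hxxc _)
  have i4 := int S.memLp_u hx hxc
  have i5 := int S.memLp_v hφ hc
  have i6 := int S.memLp_u hρ hρc
  have i7 := int S.memLp_v hρ hρc
  have e1' : (-1) * (∫ p, u p * dirDeriv (0, 1) φ p)
      + 1 * (∫ p, u p * dirDeriv (0, 1) (dirDeriv (1, 0) (dirDeriv (1, 0) φ)) p)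
      + c * (∫ p, u p * dirDeriv (1, 0) (dirDeriv (1, 0) (dirDeriv (1, 0) φ)) p)
      + 1 * (∫ p, q p * v p * φ p) + 0 * (∫ p, v p * φ p) = 0 := by
    refine Eq.trans ?_ e1
    rw [← integral_linear_comb i1 i2 i3 hq i5]
    congr 1
    ext p
    ring
  have e4 : ∫ p, u p * dirDeriv (1, 0) (dirDeriv (c, 1) fun x => φ x + dirDeriv (1, 0) φ x) p
      = 1 * (∫ p, u p * dirDeriv (c, 1) (fun x => φ x + dirDeriv (1, 0) φ x) p)
        + (-1) * (∫ p, u p * dirDeriv (0, 1) φ p)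
        + 1 * (∫ p, u p * dirDeriv (0, 1) (dirDeriv (1, 0) (dirDeriv (1, 0) φ)) p)
        + c * (∫ p, u p * dirDeriv (1, 0) (dirDeriv (1, 0) (dirDeriv (1, 0) φ)) p)
        + (-c) * ∫ p, u p * dirDeriv (1, 0) φ p := by
    rw [← integral_linear_comb i6 i1 i2 i3 i4]
    congr 1
    ext p
    rw [key p]
    ring
  have e5 : ∫ p, (u p + v p) * dirDeriv (c, 1) (fun x => φ x + dirDeriv (1, 0) φ x) p
      = (∫ p, u p * dirDeriv (c, 1) (fun x => φ x + dirDeriv (1, 0) φ x) p)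
        + ∫ p, v p * dirDeriv (c, 1) (fun x => φ x + dirDeriv (1, 0) φ x) p := by
    rw [← integral_add i6 i7]
    congr 1
    ext p
    ring
  have e6 : ∫ p, (q p - c) * v p * φ p = (∫ p, q p * v p * φ p) - c * ∫ p, v p * φ p := by
    rw [← integral_const_mul, ← integral_sub hq (i5.const_mul c)]
    congr 1
    ext p
    ring
  rw [e5, e6]
  have e7 : c * ∫ p, u p * dirDeriv (1, 0) φ p = - (c * ∫ p, v p * φ p) := by rw [e2]; ring
  linarith

end

end PlaneSolution

/-! ### Carleman estimates -/

lemma contDiff_deriv {χ : ℝ → ℝ} (hχ : ContDiff ℝ ∞ χ) : ContDiff ℝ ∞ (deriv χ) :=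
  (contDiff_infty_iff_deriv.1 hχ).2

namespace PlaneSolution

variable {c T a b M : ℝ} {q u v : ℝ × ℝ → ℝ} (S : PlaneSolution c T a b M q u v)
include S

lemma memLp_weight_sum (s μ : ℝ) {χ : ℝ → ℝ} (hχ : ContDiff ℝ ∞ χ) :
    MemLp (fun p => weight c s μ χ p * (u p + v p)) 2 volume :=
  memLp_continuous_mul S.memLp_sum S.sum_eq_zero (contDiff_weight c s μ hχ).continuous

lemma memLp_weight_u (s μ : ℝ) {χ : ℝ → ℝ} (hχ : ContDiff ℝ ∞ χ) :
    MemLp (fun p => weight c s μ χ p * u p) 2 volume :=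
  memLp_continuous_mul S.memLp_u S.u_eq_zero (contDiff_weight c s μ hχ).continuous

lemma memLp_weight_v (s μ : ℝ) {χ : ℝ → ℝ} (hχ : ContDiff ℝ ∞ χ) :
    MemLp (fun p => weight c s μ χ p * v p) 2 volume :=
  memLp_continuous_mul S.memLp_v S.v_eq_zero (contDiff_weight c s μ hχ).continuous

omit S in
lemma exists_ball_superset (a b T : ℝ) :
    ∃ R : ℝ, Ioc a b ×ˢ Ioo 0 T ⊆ Metric.ball (0 : ℝ × ℝ) R := by
  have h : Bornology.IsBounded (Icc a b ×ˢ Icc 0 T) :=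
    (isCompact_Icc.prod isCompact_Icc).isBounded
  obtain ⟨R, hR⟩ := h.subset_ball 0
  exact ⟨R, (prod_mono Ioc_subset_Icc_self Ioo_subset_Icc_self).trans hR⟩

/-- Weighted elliptic estimate for `u` in terms of `u + uₓ`. -/
lemma l2_weight_u_le {s : ℝ} (hs : 2 ≤ |s|) (μ : ℝ) {χ : ℝ → ℝ} (hχ : ContDiff ℝ ∞ χ) :
    l2 (fun p => weight c s μ χ p * u p) ≤ l2 (fun p => weight c s μ χ p * (u p + v p)) := by
  obtain ⟨R, hR⟩ := exists_ball_superset a b T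
  have hs1 : 1 ≤ |s - 1| := by
    have := abs_sub_abs_le_abs_sub s 1
    rw [abs_one] at this
    linarith
  refine l2_le_of_forall_test (S.memLp_weight_u s μ hχ) fun m hm hc => ?_
  -- With `w` the weight, `(∂_x - 1)(w ρ) = w (ρ_x + (s - 1) ρ) = w m` on the rectangle, and `∂_x -
  -- 1` is minus the adjoint of `1 + ∂_x`. This is the reason for `κ = s - 1`.
  obtain ⟨ρ, hρ, hρc, heq, -, hle⟩ := exists_dirDeriv_add_mul_eq (e := (1, 0)) (by simp)
    (κ := s - 1) (fun h => by rw [h, abs_zero] at hs1; linarith) R hm hc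
  have hw := contDiff_weight c s μ hχ
  have hφ : ContDiff ℝ ∞ fun p => weight c s μ χ p * ρ p := hw.mul hρ
  have hφc : HasCompactSupport fun p => weight c s μ χ p * ρ p := hρc.mul_left
  have e1 := S.weak_dx _ hφ hφc
  have i1 : Integrable fun p => u p * dirDeriv (1, 0) (fun p => weight c s μ χ p * ρ p) p :=
    S.memLp_u.integrable_mul (memLp_two_of_contDiff (contDiff_dirDeriv hφ _)
      (hasCompactSupport_dirDeriv hφc _))
  have i2 : Integrable fun p => v p * (weight c s μ χ p * ρ p) :=
    S.memLp_v.integrable_mul (memLp_two_of_contDiff hφ hφc)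
  have i3 : Integrable fun p => u p * (weight c s μ χ p * ρ p) :=
    S.memLp_u.integrable_mul (memLp_two_of_contDiff hφ hφc)
  have e2 : ∫ p, weight c s μ χ p * u p * m p
      = - ∫ p, weight c s μ χ p * (u p + v p) * ρ p := by
    have h1 : ∫ p, weight c s μ χ p * u p * m p
        = (∫ p, u p * dirDeriv (1, 0) (fun p => weight c s μ χ p * ρ p) p)
          - ∫ p, u p * (weight c s μ χ p * ρ p) := by
      rw [← integral_sub i1 i3]
      congr 1
      ext p
      rw [dirDeriv_mul hw hρ, dirDeriv_weight_space c s μ hχ]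
      by_cases hp : p ∈ Ioc a b ×ˢ Ioo 0 T
      · rw [← heq p (hR hp)]
        ring
      · rw [S.u_eq_zero p hp]
        ring
    have h2 : ∫ p, weight c s μ χ p * (u p + v p) * ρ p
        = (∫ p, u p * (weight c s μ χ p * ρ p)) + ∫ p, v p * (weight c s μ χ p * ρ p) := by
      rw [← integral_add i3 i2]
      congr 1
      ext p
      ring
    rw [h1, h2, e1]
    ring
  rw [e2, abs_neg]
  refine (abs_integral_mul_le_l2 (S.memLp_weight_sum s μ hχ)
    (memLp_two_of_contDiff hρ hρc)).trans ?_
  refine mul_le_mul_of_nonneg_left (hle.trans ?_) (l2_nonneg _)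
  exact mul_le_of_le_one_left (l2_nonneg _) (inv_le_one_of_one_le₀ hs1)

lemma l2_weight_v_le {s : ℝ} (hs : 2 ≤ |s|) (μ : ℝ) {χ : ℝ → ℝ} (hχ : ContDiff ℝ ∞ χ) :
    l2 (fun p => weight c s μ χ p * v p) ≤ 2 * l2 (fun p => weight c s μ χ p * (u p + v p)) := by
  have h1 := S.l2_weight_u_le hs μ hχ
  have h2 := l2_add_le (S.memLp_weight_sum s μ hχ) (S.memLp_weight_u s μ hχ).neg
  have h3 : (fun p => weight c s μ χ p * v p) = fun p => weight c s μ χ p * (u p + v p)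
      + (-fun p => weight c s μ χ p * u p) p := by
    ext p
    simp only [Pi.neg_apply]
    ring
  have h4 : l2 (-fun p => weight c s μ χ p * u p) = l2 fun p => weight c s μ χ p * u p := by
    rw [l2, l2, eLpNorm_neg]
  rw [h3]
  linarith

/-- Weighted transport estimate for `u + uₓ`; the cut-off vanishes
near the final time if `0 < μ` and near the initial time if `μ < 0`. -/
lemma l2_weight_sum_le_add {s : ℝ} (hs : 2 ≤ |s|) {μ : ℝ} (hμ : μ ≠ 0) {χ : ℝ → ℝ}
    (hχ : ContDiff ℝ ∞ χ) {ε : ℝ} (hε : 0 < ε)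
    (hpos : 0 < μ → ∀ t, χ t ≠ 0 → t ≤ T - ε) (hneg : μ < 0 → ∀ t, χ t ≠ 0 → ε ≤ t) :
    l2 (fun p => weight c s μ χ p * (u p + v p)) ≤ |μ|⁻¹ *
      ((M + |c|) * l2 (fun p => weight c s μ χ p * v p)
        + l2 (fun p => weight c s μ (deriv χ) p * (u p + v p))) := by
  obtain ⟨R, hR⟩ := exists_ball_superset a b T
  have hs1 : 1 ≤ |1 + s| := by
    have := abs_sub_abs_le_abs_sub s (-1)
    rw [abs_neg, abs_one, sub_neg_eq_add, add_comm s] at this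
    linarith
  have hM : 0 ≤ M + |c| := by
    obtain ⟨p, hp⟩ := S.q_le.exists
    linarith [abs_nonneg (q p), abs_nonneg c]
  have hχ' := contDiff_deriv hχ
  have hB : 0 ≤ |μ|⁻¹ * ((M + |c|) * l2 (fun p => weight c s μ χ p * v p)
        + l2 (fun p => weight c s μ (deriv χ) p * (u p + v p))) := by
    have h1 := l2_nonneg (fun p => weight c s μ χ p * v p)
    have h2 := l2_nonneg (fun p => weight c s μ (deriv χ) p * (u p + v p))
    positivity
  refine l2_le_of_forall_test_pos (ℓ := fun p => if 0 < μ then p.2 else T - p.2)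
    (S.memLp_weight_sum s μ hχ) ?_ ?_ hB fun m hm hc hsupp => ?_
  · split_ifs
    · exact contDiff_snd
    · exact contDiff_const.sub contDiff_snd
  · intro p hp
    rw [S.sum_eq_zero p, mul_zero]
    rintro ⟨-, h1, h2⟩
    split_ifs at hp <;> linarith
  obtain ⟨ε', hε', hm0⟩ := hsupp
  -- The dual problem is solved one factor at a time. With `w` the weight, `(1 + ∂_x)(w π) = w η`
  -- near the rectangle, and the transport derivative of `w η` is `w m` plus the commutator `χ'`
  -- term.
  obtain ⟨η, hη, hηc, hηeq, hηs, hηle⟩ := exists_dirDeriv_add_mul_eq (e := (c, 1)) (by simp) hμ R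
    hm hc
  obtain ⟨π, hπ, hπc, hπeq, hπs, hπle⟩ := exists_dirDeriv_add_mul_eq (e := (1, 0)) (by simp)
    (κ := 1 + s) (fun h => by rw [h, abs_zero] at hs1; linarith) R hη hηc
  have hw := contDiff_weight c s μ hχ
  have hφ : ContDiff ℝ ∞ fun p => weight c s μ χ p * π p := hw.mul hπ
  have hφc : HasCompactSupport fun p => weight c s μ χ p * π p := hπc.mul_left
  -- No data at `t = 0` or `t = T` are used. Passing from `η` to `π` moves the support only in `x`;
  -- `η` lies later than `m` if `0 < μ` and earlier if `μ < 0`. So the margin of `m` protects one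
  -- end of the time interval and `χ` the other.
  have hsupp : ∃ δ > 0, ∀ p, weight c s μ χ p * π p ≠ 0 → δ ≤ p.2 ∧ p.2 ≤ T - δ := by
    refine ⟨min ε ε', lt_min hε hε', fun p hp => ?_⟩
    have hp1 : χ p.2 ≠ 0 := left_ne_zero_of_mul (left_ne_zero_of_mul hp)
    obtain ⟨r, -, hr⟩ := hπs p (right_ne_zero_of_mul hp)
    obtain ⟨r', hr', hmr⟩ := hηs _ hr
    have h1 := hm0 _ hmr
    simp only [Prod.snd_sub, Prod.smul_mk, smul_eq_mul, mul_zero, mul_one, sub_zero] at h1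
    have m1 := min_le_left ε ε'
    have m2 := min_le_right ε ε'
    split_ifs at h1 with hμ0
    · have h2 := hpos hμ0 _ hp1
      have h3 : 0 ≤ r' := nonneg_of_mul_nonneg_right hr' hμ0
      constructor <;> linarith
    · have hμ1 : μ < 0 := lt_of_le_of_ne (not_lt.1 hμ0) hμ
      have h2 := hneg hμ1 _ hp1
      have h3 : r' ≤ 0 := by
        by_contra! h
        nlinarith
      constructor <;> linarith
  have e1 := S.integral_sum_mul_transport hφ hφc hsupp
  have hinner : ∀ p, weight c s μ χ p * π p
      + dirDeriv (1, 0) (fun p => weight c s μ χ p * π p) p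
      = weight c s μ χ p * (dirDeriv (1, 0) π p + (1 + s) * π p) := by
    intro p
    rw [dirDeriv_mul hw hπ, dirDeriv_weight_space c s μ hχ]
    ring
  have hpt : ∀ p ∈ Ioc a b ×ˢ Ioo 0 T, dirDeriv (c, 1) (fun p => weight c s μ χ p * π p
      + dirDeriv (1, 0) (fun p => weight c s μ χ p * π p) p) p
      = weight c s μ χ p * m p + weight c s μ (deriv χ) p * η p := by
    intro p hp
    have hev : (fun p => weight c s μ χ p * π p
        + dirDeriv (1, 0) (fun p => weight c s μ χ p * π p) p)
        =ᶠ[nhds p] fun p => weight c s μ χ p * η p := by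
      filter_upwards [Metric.isOpen_ball.mem_nhds (hR hp)] with x hx
      rw [hinner, hπeq x hx]
    rw [dirDeriv_congr hev, dirDeriv_mul hw hη, dirDeriv_weight_transport c s μ hχ,
      ← hηeq p (hR hp)]
    ring
  have j1 : Integrable fun p => weight c s μ χ p * (u p + v p) * m p :=
    (S.memLp_weight_sum s μ hχ).integrable_mul (memLp_two_of_contDiff hm hc)
  have j2 : Integrable fun p => weight c s μ (deriv χ) p * (u p + v p) * η p :=
    (S.memLp_weight_sum s μ hχ').integrable_mul (memLp_two_of_contDiff hη hηc)
  have e2 : ∫ p, weight c s μ χ p * (u p + v p) * m p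
      = (∫ p, (q p - c) * (weight c s μ χ p * v p) * π p)
        - ∫ p, weight c s μ (deriv χ) p * (u p + v p) * η p := by
    rw [eq_sub_iff_add_eq, ← integral_add j1 j2]
    refine Eq.trans ?_ (e1.trans ?_)
    · congr 1
      ext p
      by_cases hp : p ∈ Ioc a b ×ˢ Ioo 0 T
      · rw [hpt p hp]
        ring
      · rw [S.sum_eq_zero p hp]
        ring
    · congr 1
      ext p
      ring
  have hv := S.memLp_weight_v s μ hχ
  have hqv := S.memLp_coef_mul hv
  have hqv_le : l2 (fun p => (q p - c) * (weight c s μ χ p * v p))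
      ≤ (M + |c|) * l2 (fun p => weight c s μ χ p * v p) := by
    refine l2_le_mul_l2 hv hM ?_
    filter_upwards [S.q_le] with p hp
    rw [abs_mul]
    refine mul_le_mul_of_nonneg_right ?_ (abs_nonneg _)
    exact (abs_sub _ _).trans (add_le_add hp le_rfl)
  have hπm : l2 π ≤ |μ|⁻¹ * l2 m :=
    (hπle.trans (mul_le_of_le_one_left (l2_nonneg _) (inv_le_one_of_one_le₀ hs1))).trans hηle
  have t1 := abs_integral_mul_le_l2 hqv (memLp_two_of_contDiff hπ hπc)
  have t2 := abs_integral_mul_le_l2 (S.memLp_weight_sum s μ hχ') (memLp_two_of_contDiff hη hηc)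
  have t3 := mul_le_mul hqv_le hπm (l2_nonneg _) (mul_nonneg hM (l2_nonneg _))
  have t4 := mul_le_mul_of_nonneg_left hηle
    (l2_nonneg fun p => weight c s μ (deriv χ) p * (u p + v p))
  rw [e2]
  refine (abs_sub _ _).trans ?_
  linarith

/-- Carleman estimate: the cut-off commutator controls the solution. -/
lemma l2_weight_sum_le {s : ℝ} (hs : 2 ≤ |s|) {μ : ℝ} (hμ0 : μ ≠ 0) (hμ : 4 * (M + |c|) ≤ |μ|)
    {χ : ℝ → ℝ} (hχ : ContDiff ℝ ∞ χ) {ε : ℝ} (hε : 0 < ε)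
    (hpos : 0 < μ → ∀ t, χ t ≠ 0 → t ≤ T - ε) (hneg : μ < 0 → ∀ t, χ t ≠ 0 → ε ≤ t) :
    l2 (fun p => weight c s μ χ p * (u p + v p)) ≤
      2 * |μ|⁻¹ * l2 (fun p => weight c s μ (deriv χ) p * (u p + v p)) := by
  have h1 := S.l2_weight_sum_le_add hs hμ0 hχ hε hpos hneg
  have h2 := S.l2_weight_v_le hs μ hχ
  have h3 := l2_nonneg fun p => weight c s μ χ p * v p
  have h5 := l2_nonneg fun p => weight c s μ χ p * (u p + v p)
  have hμ' : 0 < |μ| := abs_pos.2 hμ0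
  -- The factor `2` of `l2_weight_v_le` and the threshold `4 * (M + |c|)` leave the coefficient `1 /
  -- 2`, which is absorbed on the left.
  have h4 : |μ|⁻¹ * ((M + |c|) * l2 (fun p => weight c s μ χ p * v p))
      ≤ 1 / 2 * l2 (fun p => weight c s μ χ p * (u p + v p)) := by
    rw [inv_mul_le_iff₀ hμ']
    nlinarith
  linarith

/-! ### Unique continuation on the plane -/

omit S in
lemma le_zero_of_forall_le_mul_exp {x A δ : ℝ} (hδ : 0 < δ)
    (h : ∀ n : ℕ, 2 ≤ n → x ≤ A * Real.exp (-(n * δ))) : x ≤ 0 := by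
  have hlim : Filter.Tendsto (fun n : ℕ => A * Real.exp (-(n * δ))) Filter.atTop (nhds (A * 0)) := by
    refine Filter.Tendsto.const_mul A (Real.tendsto_exp_neg_atTop_nhds_zero.comp ?_)
    exact tendsto_natCast_atTop_atTop.atTop_mul_const hδ
  rw [mul_zero] at hlim
  exact ge_of_tendsto hlim (Filter.eventually_atTop.2 ⟨2, h⟩)

/-- Letting the Carleman parameter tend to infinity: `u + uₓ` vanishes where the weight exceeds
its maximum on the support of the commutator. -/
lemma ae_sum_eq_zero_of_lt {d : ℝ} (hd : |d| = 1) {μ : ℝ} (hμ0 : μ ≠ 0)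
    (hμ : 4 * (M + |c|) ≤ |μ|) {χ : ℝ → ℝ} (hχ : ContDiff ℝ ∞ χ) {ε : ℝ} (hε : 0 < ε)
    (hpos : 0 < μ → ∀ t, χ t ≠ 0 → t ≤ T - ε) (hneg : μ < 0 → ∀ t, χ t ≠ 0 → ε ≤ t) {K : ℝ}
    (hK : ∀ p ∈ Ioc a b ×ˢ Ioo 0 T, deriv χ p.2 ≠ 0 → d * (p.1 - c * p.2) ≤ K) :
    ∀ᵐ p, χ p.2 = 1 → K < d * (p.1 - c * p.2) → u p + v p = 0 := by
  have hχ' := contDiff_deriv hχ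
  have hexp : ∀ p ∈ Ioc a b ×ˢ Ioo 0 T, |μ * p.2| ≤ |μ| * T := by
    rintro p ⟨-, h1, h2⟩
    rw [abs_mul, abs_of_pos h1]
    exact mul_le_mul_of_nonneg_left h2.le (abs_nonneg _)
  have hz' : MemLp (fun p => weight c 0 0 (deriv χ) p * (u p + v p)) 2 volume :=
    S.memLp_weight_sum 0 0 hχ'
  have step : ∀ δ : ℝ, 0 < δ → ∀ᵐ p, χ p.2 = 1 → K + δ ≤ d * (p.1 - c * p.2) → u p + v p = 0 := by
    intro δ hδ
    let A : Set (ℝ × ℝ) := {p | χ p.2 = 1 ∧ K + δ ≤ d * (p.1 - c * p.2)}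
    have hA : MeasurableSet A := by
      refine (IsClosed.inter (s₁ := {p : ℝ × ℝ | χ p.2 = 1})
        (s₂ := {p : ℝ × ℝ | K + δ ≤ d * (p.1 - c * p.2)}) ?_ ?_).measurableSet
      · exact isClosed_eq (hχ.continuous.comp continuous_snd) continuous_const
      · exact isClosed_le continuous_const (by fun_prop)
    have hAm : MemLp (A.indicator fun p => u p + v p) 2 volume := S.memLp_sum.indicator hA
    have hzero : l2 (A.indicator fun p => u p + v p) ≤ 0 := by
      -- Take `s = n * d`. On the rectangle the weight is at least `exp (n (K + δ) - |μ| T)` on `A`,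
      -- and the exponential is at most `exp (n K + |μ| T)` on the support of the commutator. The
      -- quotient decays like `exp (-n δ)`. The weight with `s = μ = 0` is the bare cut-off
      -- derivative.
      refine le_zero_of_forall_le_mul_exp (A := Real.exp (|μ| * T) * (2 * |μ|⁻¹ *
        (Real.exp (|μ| * T) * l2 fun p => weight c 0 0 (deriv χ) p * (u p + v p)))) hδ
        fun n hn => ?_
      have hn2 : (2 : ℝ) ≤ n := by exact_mod_cast hn
      have hs : 2 ≤ |n * d| := by
        rw [abs_mul, hd, mul_one, abs_of_nonneg (by positivity)]
        exact hn2
      have h0 := S.l2_weight_sum_le hs hμ0 hμ hχ hε hpos hneg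
      have h1 : l2 (A.indicator fun p => u p + v p) ≤ Real.exp (|μ| * T - n * (K + δ)) *
          l2 (fun p => weight c (n * d) μ χ p * (u p + v p)) := by
        refine l2_le_mul_l2 (S.memLp_weight_sum _ μ hχ) (Real.exp_pos _).le
          (Filter.Eventually.of_forall fun p => ?_)
        by_cases hp : p ∈ Ioc a b ×ˢ Ioo 0 T
        · by_cases hpA : p ∈ A
          · rw [indicator_of_mem hpA, weight, hpA.1, one_mul, abs_mul, ← mul_assoc,
              abs_of_pos (Real.exp_pos _), ← Real.exp_add]
            refine le_mul_of_one_le_left (abs_nonneg _) (Real.one_le_exp ?_)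
            have h3 := neg_abs_le (μ * p.2)
            have h4 := hexp p hp
            have h5 : (n : ℝ) * (K + δ) ≤ n * (d * (p.1 - c * p.2)) :=
              mul_le_mul_of_nonneg_left hpA.2 (by positivity)
            linarith
          · rw [indicator_of_notMem hpA, abs_zero]
            positivity
        · have : A.indicator (fun p => u p + v p) p = 0 := by
            by_cases hpA : p ∈ A
            · rw [indicator_of_mem hpA, S.sum_eq_zero p hp]
            · rw [indicator_of_notMem hpA]
          rw [this, abs_zero]
          positivity
      have h2 : l2 (fun p => weight c (n * d) μ (deriv χ) p * (u p + v p)) ≤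
          Real.exp (n * K + |μ| * T) * l2 fun p => weight c 0 0 (deriv χ) p * (u p + v p) := by
        refine l2_le_mul_l2 hz' (Real.exp_pos _).le (Filter.Eventually.of_forall fun p => ?_)
        by_cases hp : p ∈ Ioc a b ×ˢ Ioo 0 T
        · by_cases hpχ : deriv χ p.2 = 0
          · simp [weight, hpχ]
          · have h3 := le_abs_self (μ * p.2)
            have h4 := hexp p hp
            have h5 : n * (d * (p.1 - c * p.2)) ≤ (n : ℝ) * K :=
              mul_le_mul_of_nonneg_left (hK p hp hpχ) (by positivity)
            simp only [weight, zero_mul, add_zero, Real.exp_zero, mul_one, abs_mul,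
              abs_of_pos (Real.exp_pos _)]
            rw [mul_comm |deriv χ p.2|, mul_assoc]
            refine mul_le_mul_of_nonneg_right (Real.exp_le_exp.2 ?_) (by positivity)
            linarith
        · rw [S.sum_eq_zero p hp]
          simp
      calc l2 (A.indicator fun p => u p + v p)
          ≤ Real.exp (|μ| * T - n * (K + δ)) * (2 * |μ|⁻¹ * (Real.exp (n * K + |μ| * T) *
            l2 fun p => weight c 0 0 (deriv χ) p * (u p + v p))) := by
            refine h1.trans (mul_le_mul_of_nonneg_left ?_ (Real.exp_pos _).le)
            exact h0.trans (mul_le_mul_of_nonneg_left h2 (by positivity))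
        _ = _ := by
            have e1 : Real.exp (|μ| * T - n * (K + δ))
                = Real.exp (|μ| * T) * Real.exp (-(n * δ)) * Real.exp (-(n * K)) := by
              rw [← Real.exp_add, ← Real.exp_add]
              congr 1
              ring
            have e2 : Real.exp (-(n * K)) * Real.exp (n * K + |μ| * T) = Real.exp (|μ| * T) := by
              rw [← Real.exp_add]
              congr 1
              ring
            rw [e1]
            linear_combination (Real.exp (|μ| * T) * Real.exp (-(n * δ)) * (2 * |μ|⁻¹ *
              l2 fun p => weight c 0 0 (deriv χ) p * (u p + v p))) * e2
    filter_upwards [ae_eq_zero_of_l2_eq_zero hAm (le_antisymm hzero (l2_nonneg _))] with p hp h1 h2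
    rwa [indicator_of_mem (show p ∈ A from ⟨h1, h2⟩)] at hp
  have hall : ∀ᵐ p, ∀ n : ℕ, χ p.2 = 1 → K + 1 / ((n : ℝ) + 1) ≤ d * (p.1 - c * p.2) →
      u p + v p = 0 := ae_all_iff.2 fun n => step _ (by positivity)
  filter_upwards [hall] with p hp h1 h2
  obtain ⟨n, hn⟩ := exists_nat_one_div_lt (sub_pos.2 h2)
  exact hp n h1 (by linarith)

omit S in
lemma deriv_eq_zero_of_eqOn {χ : ℝ → ℝ} {U : Set ℝ} (hU : IsOpen U) {k : ℝ}
    (h : ∀ t ∈ U, χ t = k) {t : ℝ} (ht : t ∈ U) : deriv χ t = 0 := by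
  have : χ =ᶠ[nhds t] fun _ => k := by
    filter_upwards [hU.mem_nhds ht] with x hx using h x hx
  rw [this.deriv_eq, deriv_const]

/-- Unique continuation for compactly supported solutions: a solution supported in `a ≤ x ≤ b`
during a time longer than `(b - a) / |c|` vanishes. -/
theorem ae_eq_zero (hc : c ≠ 0) (hT : b - a < |c| * T) : ∀ᵐ p, u p = 0 := by
  have hc' : 0 < |c| := abs_pos.2 hc
  have hM : 0 ≤ M := by
    obtain ⟨p, hp⟩ := S.q_le.exists
    exact (abs_nonneg _).trans hp
  -- Each cut-off loses time `2 * ε` at its end. The choice below spends half of the gap `|c| * T -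
  -- (b - a)`.
  obtain ⟨ε, hε, hεT⟩ : ∃ ε > 0, b - a < |c| * (T - 4 * ε) := by
    refine ⟨(|c| * T - (b - a)) / (8 * |c|), div_pos (by linarith) (by positivity), ?_⟩
    have : |c| * (T - 4 * ((|c| * T - (b - a)) / (8 * |c|)))
        = |c| * T - (|c| * T - (b - a)) / 2 := by
      field_simp
      ring
    rw [this]
    linarith
  obtain ⟨d, hd, hdc⟩ : ∃ d : ℝ, |d| = 1 ∧ d * c = |c| := by
    rcases hc.lt_or_gt with h | h
    · exact ⟨-1, by simp, by rw [abs_of_neg h]; ring⟩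
    · exact ⟨1, by simp, by rw [abs_of_pos h]; ring⟩
  obtain ⟨k, hk⟩ : ∃ k : ℝ, ∀ x ∈ Ioc a b, k ≤ d * x ∧ d * x ≤ k + (b - a) := by
    rcases (abs_eq zero_le_one).1 hd with h | h
    · exact ⟨a, fun x hx => by rw [h]; constructor <;> linarith [hx.1, hx.2]⟩
    · exact ⟨-b, fun x hx => by rw [h]; constructor <;> linarith [hx.1, hx.2]⟩
  have hdx : ∀ p : ℝ × ℝ, d * (p.1 - c * p.2) = d * p.1 - |c| * p.2 := fun p => by
    rw [← hdc]; ring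
  let μ : ℝ := 4 * (M + |c|)
  have hμ : 0 < μ := by positivity
  have hlin : ∀ α β : ℝ, ContDiff ℝ ∞ fun t : ℝ => Real.smoothTransition ((α + β * t) / ε) :=
    fun α β => Real.smoothTransition.contDiff.comp (by fun_prop)
  let χ₁ : ℝ → ℝ := fun t => Real.smoothTransition ((T - ε + (-1) * t) / ε)
  let χ₂ : ℝ → ℝ := fun t => Real.smoothTransition ((-ε + 1 * t) / ε)
  have hχ₁one : ∀ t, t ≤ T - 2 * ε → χ₁ t = 1 := fun t ht =>
    Real.smoothTransition.one_of_one_le (by rw [le_div_iff₀ hε]; linarith)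
  have hχ₂one : ∀ t, 2 * ε ≤ t → χ₂ t = 1 := fun t ht =>
    Real.smoothTransition.one_of_one_le (by rw [le_div_iff₀ hε]; linarith)
  have z₁ := S.ae_sum_eq_zero_of_lt (d := d) hd (μ := μ) hμ.ne' (by rw [abs_of_pos hμ])
    (χ := χ₁) (hlin _ _) hε
    (fun _ t ht => by
      by_contra! h
      exact ht (Real.smoothTransition.zero_of_nonpos
        (div_nonpos_of_nonpos_of_nonneg (by linarith) hε.le)))
    (fun h => absurd h hμ.not_gt) (K := k + (b - a) - |c| * (T - 2 * ε))
    (fun p hp hp' => by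
      have ht : T - 2 * ε ≤ p.2 := by
        by_contra! h
        exact hp' (deriv_eq_zero_of_eqOn isOpen_Iio (fun t ht => hχ₁one t (le_of_lt ht)) h)
      have := mul_le_mul_of_nonneg_left ht hc'.le
      rw [hdx]
      linarith [(hk p.1 hp.1).2])
  have z₂ := S.ae_sum_eq_zero_of_lt (d := -d) (by rwa [abs_neg]) (μ := -μ) (neg_ne_zero.2 hμ.ne')
    (by rw [abs_neg, abs_of_pos hμ]) (χ := χ₂) (hlin _ _) hε
    (fun h => absurd h (by linarith))
    (fun _ t ht => by
      by_contra! h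
      exact ht (Real.smoothTransition.zero_of_nonpos
        (div_nonpos_of_nonpos_of_nonneg (by linarith) hε.le)))
    (K := -k + |c| * (2 * ε))
    (fun p hp hp' => by
      have ht : p.2 ≤ 2 * ε := by
        by_contra! h
        exact hp' (deriv_eq_zero_of_eqOn isOpen_Ioi (fun t ht => hχ₂one t (le_of_lt ht)) h)
      have := mul_le_mul_of_nonneg_left ht hc'.le
      rw [neg_mul, hdx]
      linarith [(hk p.1 hp.1).1])
  -- A point not reached by `z₁` has `d x - |c| t ≤ k + (b - a) - |c| (T - 2ε)`, which is below `k -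
  -- 2ε |c|` by the choice of `ε`. As `d x ≥ k`, this also forces `t > 2ε`, so `z₂` applies.
  have hz : ∀ᵐ p, u p + v p = 0 := by
    filter_upwards [z₁, z₂] with p h1 h2
    by_cases hp : p ∈ Ioc a b ×ˢ Ioo 0 T
    · rw [hdx] at h1
      rw [neg_mul, hdx] at h2
      have hk' := hk p.1 hp.1
      by_cases hA : p.2 ≤ T - 2 * ε ∧ k + (b - a) - |c| * (T - 2 * ε) < d * p.1 - |c| * p.2
      · exact h1 (hχ₁one _ hA.1) hA.2
      · have hB : d * p.1 - |c| * p.2 ≤ k + (b - a) - |c| * (T - 2 * ε) := by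
          by_contra! hlt
          have ht : T - 2 * ε < p.2 := by
            by_contra! hle
            exact hA ⟨hle, hlt⟩
          have := mul_lt_mul_of_pos_left ht hc'
          linarith
        have hC : d * p.1 - |c| * p.2 < k - |c| * (2 * ε) := by linarith
        refine h2 (hχ₂one _ ?_) (by linarith)
        have : |c| * (2 * ε) < |c| * p.2 := by linarith
        exact (lt_of_mul_lt_mul_left this hc'.le).le
    · exact S.sum_eq_zero p hp
  -- The elliptic estimate without time cut-off recovers `u` from `u + u_x = 0`; `s = 2` is an
  -- admissible exponent.
  have h1 := S.l2_weight_u_le (s := 2) (by norm_num) 0 (χ := fun _ => 1) contDiff_const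
  have h2 : l2 (fun p => weight c 2 0 (fun _ => 1) p * (u p + v p)) = 0 := by
    rw [l2, eLpNorm_congr_ae (g := 0), eLpNorm_zero, ENNReal.toReal_zero]
    filter_upwards [hz] with p hp
    rw [hp, mul_zero, Pi.zero_apply]
  rw [h2] at h1
  filter_upwards [ae_eq_zero_of_l2_eq_zero (S.memLp_weight_u 2 0 contDiff_const)
    (le_antisymm h1 (l2_nonneg _))] with p hp
  refine (mul_eq_zero.1 hp).resolve_left ?_
  simp [weight, Real.exp_ne_zero]

end PlaneSolution

/-! ### Functions on the fundamental domain transplanted to the torus -/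

namespace KdVBBM

/-- The function on the cylinder that equals `g` on the fundamental domain `a < x ≤ a + 2π`. -/
noncomputable def periodize (a : ℝ) (g : ℝ × ℝ → ℝ) : Torus × ℝ → ℝ :=
  fun p => g ((AddCircle.equivIoc (2 * Real.pi) a p.1 : ℝ), p.2)

/-- `g` is smooth and vanishes near the ends of the fundamental domain `a < x ≤ a + 2π`. -/
structure IsInner (a : ℝ) (g : ℝ × ℝ → ℝ) : Prop where
  contDiff : ContDiff ℝ ∞ g
  exists_margin : ∃ δ > 0, ∀ p : ℝ × ℝ, p.1 < a + δ ∨ a + 2 * Real.pi - δ < p.1 → g p = 0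

lemma periodize_coe {a : ℝ} (g : ℝ × ℝ → ℝ) {x : ℝ} (hx : x ∈ Ioc a (a + 2 * Real.pi)) (t : ℝ) :
    periodize a g ((x : Torus), t) = g (x, t) := by
  rw [periodize, AddCircle.equivIoc_coe_of_mem hx]

lemma exists_mem_Ioc_coe (a : ℝ) (y : Torus) : ∃ x ∈ Ioc a (a + 2 * Real.pi), (x : Torus) = y :=
  ⟨_, (AddCircle.equivIoc (2 * Real.pi) a y).2, (AddCircle.equivIoc (2 * Real.pi) a).left_inv y⟩

lemma measurable_periodize (a : ℝ) {g : ℝ × ℝ → ℝ} (hg : Measurable g) :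
    Measurable (periodize a g) := by
  refine hg.comp (Measurable.prodMk ?_ measurable_snd)
  exact measurable_subtype_coe.comp
    ((AddCircle.measurableEquivIoc (2 * Real.pi) a).measurable.comp measurable_fst)

/-- Only the end `x = a + 2π` is delicate: points beyond it wrap around to the left end, and there
the margin makes both values zero. -/
lemma IsInner.exists_eventuallyEq {a : ℝ} {g : ℝ × ℝ → ℝ} (hg : IsInner a g) {x : ℝ}
    (hx : x ∈ Ioc a (a + 2 * Real.pi)) :
    ∀ᶠ y : ℝ in nhds x, ∀ t, periodize a g ((y : Torus), t) = g (y, t) := by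
  obtain ⟨δ, hδ, h0⟩ := hg.exists_margin
  have hpi := Real.two_pi_pos
  rcases hx.2.lt_or_eq with h | h
  · filter_upwards [Ioo_mem_nhds hx.1 h] with y hy t
    exact periodize_coe g ⟨hy.1, hy.2.le⟩ t
  · have h1 : x - min δ (2 * Real.pi) < x := by linarith [lt_min hδ hpi]
    have h2 : x < x + min δ (2 * Real.pi) := by linarith [lt_min hδ hpi]
    filter_upwards [Ioo_mem_nhds h1 h2] with y hy t
    have m1 := min_le_left δ (2 * Real.pi)
    have m2 := min_le_right δ (2 * Real.pi)
    rcases le_or_gt y x with hyx | hyx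
    · exact periodize_coe g ⟨by linarith [hy.1], by linarith⟩ t
    · have hy' : ((y : ℝ) : Torus) = ((y - 2 * Real.pi : ℝ) : Torus) := by
        rw [AddCircle.coe_sub, AddCircle.coe_period, sub_zero]
      rw [hy', periodize_coe g ⟨by linarith, by linarith [hy.2]⟩, h0 (y, t) (Or.inr (by
        simp only; linarith)), h0 _ (Or.inl (by simp only; linarith [hy.2]))]

/-- Smoothness is local: near `p` the lift is a translate of `g` by the multiple of the period that
brings `p.1` into the fundamental domain. -/
lemma contDiff_periodize {a : ℝ} {g : ℝ × ℝ → ℝ} (hg : IsInner a g) :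
    ContDiff ℝ ∞ fun p : ℝ × ℝ => periodize a g ((p.1 : Torus), p.2) := by
  rw [contDiff_iff_contDiffAt]
  intro p
  obtain ⟨x, hx, hxp⟩ := exists_mem_Ioc_coe a (p.1 : Torus)
  have hs : ContDiffAt ℝ ∞ (fun r : ℝ × ℝ => g (r.1 + (x - p.1), r.2)) p :=
    (hg.contDiff.comp ((contDiff_fst.add contDiff_const).prodMk contDiff_snd)).contDiffAt
  refine hs.congr_of_eventuallyEq ?_
  have ht : Filter.Tendsto (fun r : ℝ × ℝ => r.1 + (x - p.1)) (nhds p) (nhds x) := by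
    have : ContinuousAt (fun r : ℝ × ℝ => r.1 + (x - p.1)) p := by fun_prop
    simpa [ContinuousAt] using this
  filter_upwards [ht.eventually (hg.exists_eventuallyEq hx)] with r hr
  rw [← hr r.2, AddCircle.coe_add, AddCircle.coe_sub, hxp, sub_self, add_zero]

lemma IsInner.dirDeriv {a : ℝ} {g : ℝ × ℝ → ℝ} (hg : IsInner a g) (e : ℝ × ℝ) :
    IsInner a (dirDeriv e g) := by
  refine ⟨contDiff_dirDeriv hg.contDiff e, ?_⟩
  obtain ⟨δ, hδ, h0⟩ := hg.exists_margin
  refine ⟨δ, hδ, fun p hp => ?_⟩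
  have hopen : IsOpen {p : ℝ × ℝ | p.1 < a + δ ∨ a + 2 * Real.pi - δ < p.1} :=
    (isOpen_lt continuous_fst continuous_const).union (isOpen_lt continuous_const continuous_fst)
  have hev : g =ᶠ[nhds p] fun _ => 0 := by
    filter_upwards [hopen.mem_nhds hp] with x hx using h0 x hx
  rw [dirDeriv_congr hev, _root_.dirDeriv]
  simp

lemma dx_periodize {a : ℝ} {g : ℝ × ℝ → ℝ} (hg : IsInner a g) :
    dx (periodize a g) = periodize a (dirDeriv (1, 0) g) := by
  ext ⟨y, t⟩
  obtain ⟨x, hx, rfl⟩ := exists_mem_Ioc_coe a y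
  rw [periodize_coe _ hx, dx]
  have ht : Filter.Tendsto (fun s : ℝ => x + s) (nhds 0) (nhds x) := by
    have : ContinuousAt (fun s : ℝ => x + s) 0 := by fun_prop
    simpa [ContinuousAt] using this
  have hev : (fun s : ℝ => periodize a g ((x : Torus) + (s : Torus), t))
      =ᶠ[nhds 0] fun s => g (x + s, t) := by
    filter_upwards [ht.eventually (hg.exists_eventuallyEq hx)] with s hs
    rw [← AddCircle.coe_add, hs t]
  rw [hev.deriv_eq]
  symm
  refine dirDeriv_eq_of_hasDerivAt (hg.contDiff.differentiable (by simp) _) ?_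
  have : DifferentiableAt ℝ (fun s : ℝ => g (x + s, t)) 0 :=
    DifferentiableAt.fun_comp' (0 : ℝ) (hg.contDiff.differentiable (by simp) _) (by fun_prop)
  simpa using this.hasDerivAt

lemma dt_periodize {a : ℝ} {g : ℝ × ℝ → ℝ} (hg : ContDiff ℝ ∞ g) :
    dt (periodize a g) = periodize a (dirDeriv (0, 1) g) := by
  ext ⟨y, t⟩
  simp only [dt, periodize]
  set x : ℝ := (AddCircle.equivIoc (2 * Real.pi) a y : ℝ)
  symm
  refine dirDeriv_eq_of_hasDerivAt (hg.differentiable (by simp) _) ?_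
  have h1 : DifferentiableAt ℝ (fun s : ℝ => g (x, s)) (t + 0) :=
    DifferentiableAt.fun_comp' _ (hg.differentiable (by simp) _) (by fun_prop)
  have h2 := h1.hasDerivAt.comp_const_add t (0 : ℝ)
  simpa using h2

lemma torusDeriv_periodize {a : ℝ} {g : ℝ × ℝ → ℝ} (hg : IsInner a g) (t : ℝ) (y : Torus) :
    torusDeriv (fun x => periodize a g (x, t)) y = periodize a (dirDeriv (1, 0) g) (y, t) := by
  rw [← dx_periodize hg]
  rfl

lemma smoothOnTorus_periodize {a : ℝ} {g : ℝ × ℝ → ℝ} (hg : IsInner a g) (t : ℝ) :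
    SmoothOnTorus fun x => periodize a g (x, t) :=
  (contDiff_periodize hg).comp (contDiff_id.prodMk contDiff_const)

lemma isTestFunction_periodize {a T : ℝ} {g : ℝ × ℝ → ℝ} (hg : IsInner a g)
    (ht : ∃ ε > 0, ∀ p, g p ≠ 0 → ε ≤ p.2 ∧ p.2 ≤ T - ε) :
    IsTestFunction T (periodize a g) := by
  obtain ⟨ε, hε, h⟩ := ht
  have hsub : Function.support (periodize a g) ⊆ univ ×ˢ Icc ε (T - ε) := fun p hp =>
    ⟨mem_univ _, h _ hp⟩
  have hts : tsupport (periodize a g) ⊆ univ ×ˢ Icc ε (T - ε) :=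
    closure_minimal hsub (isClosed_univ.prod isClosed_Icc)
  refine ⟨contDiff_periodize hg, (isCompact_univ.prod isCompact_Icc).of_isClosed_subset
    (isClosed_tsupport _) hts, hts.trans (prod_mono_right fun t ht => ?_)⟩
  exact ⟨by linarith [ht.1], by linarith [ht.2]⟩

/-! ### Integration on the cylinder and weak derivatives on slices -/

/-- The covering map from the fundamental rectangle to the cylinder. -/
noncomputable def toCylinder (p : ℝ × ℝ) : Torus × ℝ := ((p.1 : Torus), p.2)

lemma measurePreserving_toCylinder (a T : ℝ) : MeasurePreserving toCylinder
    (volume.restrict (Ioc a (a + 2 * Real.pi) ×ˢ Ioo 0 T)) (cylinder T) := by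
  rw [Measure.volume_eq_prod, ← Measure.prod_restrict]
  exact (AddCircle.measurePreserving_mk (2 * Real.pi) a).prod (MeasurePreserving.id _)

lemma integral_cylinder (a T : ℝ) {F : Torus × ℝ → ℝ} (hF : AEStronglyMeasurable F (cylinder T)) :
    ∫ p, F p ∂(cylinder T) = ∫ p in Ioc a (a + 2 * Real.pi) ×ˢ Ioo 0 T, F (toCylinder p) := by
  have h := measurePreserving_toCylinder a T
  rw [← h.map_eq, integral_map h.aemeasurable (by rwa [h.map_eq])]

instance isFiniteMeasure_cylinder (T : ℝ) : IsFiniteMeasure (cylinder T) := by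
  unfold cylinder
  infer_instance

/-- The weak derivative is unique. -/
lemma HasH1Deriv.ae_eq {f g g' : Torus → ℝ} (h : HasH1Deriv f g) (h' : HasH1Deriv f g') :
    g =ᵐ[volume] g' := by
  have hgg : MemLp (g - g') 2 volume := h.memLp_deriv.sub h'.memLp_deriv
  have hmp := AddCircle.measurePreserving_mk (2 * Real.pi) 0
  have hint : Integrable (fun x : ℝ => (g - g') (x : Torus))
      (volume.restrict (Ioc 0 (0 + 2 * Real.pi))) :=
    hmp.integrable_comp_of_integrable (hgg.integrable (by norm_num))
  have hIoo : ∀ᵐ x : ℝ, x ∈ Ioo 0 (2 * Real.pi) → (g - g') (x : Torus) = 0 := by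
    refine isOpen_Ioo.ae_eq_zero_of_integral_contDiff_smul_eq_zero
      (IntegrableOn.locallyIntegrableOn (hint.mono_measure (Measure.restrict_mono
        (by rw [zero_add]; exact Ioo_subset_Ioc_self) le_rfl))) ?_
    intro ψ hψ hψc hψs
    obtain ⟨δ, hδ, hδs⟩ : ∃ δ > 0, ∀ x, x < 0 + δ ∨ 0 + 2 * Real.pi - δ < x → ψ x = 0 := by
      obtain ⟨δ, hδ, hsub⟩ := hψc.isCompact.exists_cthickening_subset_open isOpen_Ioo hψs
      refine ⟨δ, hδ, fun x hx => ?_⟩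
      by_contra hne
      have hmem : ∀ y : ℝ, |y - x| ≤ δ → y ∈ Ioo 0 (2 * Real.pi) := fun y hy =>
        hsub (Metric.mem_cthickening_of_dist_le y x δ _ (subset_tsupport _ hne) hy)
      have h1 := hmem (x - δ) (by rw [abs_le]; constructor <;> linarith)
      have h2 := hmem (x + δ) (by rw [abs_le]; constructor <;> linarith)
      rcases hx with hx | hx
      · linarith [h1.1]
      · linarith [h2.2]
    have hin : IsInner 0 fun p : ℝ × ℝ => ψ p.1 :=
      ⟨hψ.comp contDiff_fst, δ, hδ, fun p hp => hδs _ hp⟩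
    have hsm := smoothOnTorus_periodize hin 0
    have hc : Continuous ψ := hψ.continuous
    have hbd : ∃ C, ∀ y : Torus, ‖periodize 0 (fun p : ℝ × ℝ => ψ p.1) (y, 0)‖ ≤ C := by
      obtain ⟨C, hC⟩ := hψc.exists_bound_of_continuous hc
      exact ⟨C, fun y => hC _⟩
    obtain ⟨C, hC⟩ := hbd
    have hpm : Measurable fun y : Torus => periodize 0 (fun p : ℝ × ℝ => ψ p.1) (y, 0) :=
      (measurable_periodize 0 (hc.measurable.comp measurable_fst)).comp (by fun_prop)
    have i1 := (h.memLp_deriv.integrable (by norm_num)).mul_bdd (c := C)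
      hpm.aestronglyMeasurable (Filter.Eventually.of_forall hC)
    have i2 := (h'.memLp_deriv.integrable (by norm_num)).mul_bdd (c := C)
      hpm.aestronglyMeasurable (Filter.Eventually.of_forall hC)
    have e0 : ∫ y, (g - g') y * periodize 0 (fun p : ℝ × ℝ => ψ p.1) (y, 0) = 0 := by
      have e1 := h.integral_eq _ hsm
      have e2 := h'.integral_eq _ hsm
      have : ∫ y, (g - g') y * periodize 0 (fun p : ℝ × ℝ => ψ p.1) (y, 0)
          = (∫ y, g y * periodize 0 (fun p : ℝ × ℝ => ψ p.1) (y, 0))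
            - ∫ y, g' y * periodize 0 (fun p : ℝ × ℝ => ψ p.1) (y, 0) := by
        rw [← integral_sub i1 i2]
        congr 1
        ext y
        simp only [Pi.sub_apply]
        ring
      rw [this]
      linarith
    rw [← hmp.map_eq, integral_map hmp.aemeasurable
      (by rw [hmp.map_eq]; exact hgg.1.mul hpm.aestronglyMeasurable)] at e0
    have e3 : ∫ x in Ioc 0 (0 + 2 * Real.pi), ψ x • (g - g') (x : Torus) = 0 := by
      have heq : EqOn (fun x : ℝ => ψ x • (g - g') (x : Torus))
          (fun x : ℝ => (g - g') (x : Torus) *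
            periodize 0 (fun p : ℝ × ℝ => ψ p.1) ((x : Torus), 0)) (Ioc 0 (0 + 2 * Real.pi)) := by
        intro x hx
        beta_reduce
        rw [periodize_coe _ hx, smul_eq_mul, mul_comm]
      exact (setIntegral_congr_fun measurableSet_Ioc heq).trans e0
    rw [← e3]
    symm
    refine setIntegral_eq_integral_of_forall_compl_eq_zero fun x hx => ?_
    rw [hδs x ?_, zero_smul]
    by_contra! hcon
    exact hx ⟨by linarith [hcon.1], by linarith [hcon.2]⟩
  have hIoc : (fun x : ℝ => (g - g') (x : Torus)) =ᵐ[volume.restrict (Ioc 0 (0 + 2 * Real.pi))] 0 := by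
    rw [zero_add, ← restrict_Ioo_eq_restrict_Ioc]
    exact (ae_restrict_iff' measurableSet_Ioo).2 hIoo
  have hn : eLpNorm (g - g') 2 volume = 0 := by
    rw [← eLpNorm_comp_measurePreserving hgg.1 hmp]
    exact (eLpNorm_congr_ae hIoc).trans eLpNorm_zero
  rw [eLpNorm_eq_zero_iff hgg.1 (by norm_num)] at hn
  filter_upwards [hn] with y hy
  exact sub_eq_zero.1 hy

/-- Square integrability on the cylinder from a uniform bound on the time slices. -/
lemma memLp_cylinder {T : ℝ} {f : Torus × ℝ → ℝ} (hf : AEStronglyMeasurable f (cylinder T)) {C : ℝ}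
    (h : ∀ᵐ t ∂(volume.restrict (Ioo 0 T)), MemLp (fun x => f (x, t)) 2 volume ∧
      ∫ x, f (x, t) ^ 2 ≤ C) : MemLp f 2 (cylinder T) := by
  rw [memLp_two_iff_integrable_sq hf]
  have hm : AEStronglyMeasurable (fun p => f p ^ 2) (cylinder T) := hf.pow 2
  rw [cylinder, integrable_prod_iff' hm]
  refine ⟨h.mono fun t ht => ht.1.integrable_sq, ?_⟩
  have hm' : AEStronglyMeasurable (fun t => ∫ x, ‖f (x, t) ^ 2‖) (volume.restrict (Ioo 0 T)) :=
    (AEStronglyMeasurable.prod_swap hm).norm.integral_prod_right'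
  refine Integrable.of_bound hm' C (h.mono fun t ht => ?_)
  rw [Real.norm_of_nonneg (integral_nonneg fun x => norm_nonneg _)]
  simpa using ht.2

/-! ### Cutting the torus open -/

/-- A smooth cut-off equal to `1` on `[a + δ, a + 2π - δ]`. -/
noncomputable def arcCutoff (a δ : ℝ) (p : ℝ × ℝ) : ℝ :=
  Real.smoothTransition ((p.1 - a - δ / 2) / (δ / 2)) *
    Real.smoothTransition ((a + 2 * Real.pi - p.1 - δ / 2) / (δ / 2))

lemma contDiff_arcCutoff (a δ : ℝ) : ContDiff ℝ ∞ (arcCutoff a δ) :=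
  (Real.smoothTransition.contDiff.comp (by fun_prop)).mul
    (Real.smoothTransition.contDiff.comp (by fun_prop))

lemma arcCutoff_eq_one {a δ : ℝ} (hδ : 0 < δ) {p : ℝ × ℝ} (h1 : a + δ ≤ p.1)
    (h2 : p.1 ≤ a + 2 * Real.pi - δ) : arcCutoff a δ p = 1 := by
  rw [arcCutoff, Real.smoothTransition.one_of_one_le, Real.smoothTransition.one_of_one_le, one_mul]
  · rw [le_div_iff₀ (by positivity)]; linarith
  · rw [le_div_iff₀ (by positivity)]; linarith

lemma abs_arcCutoff_le (a δ : ℝ) (p : ℝ × ℝ) : |arcCutoff a δ p| ≤ 1 := by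
  rw [arcCutoff, abs_mul, abs_of_nonneg (Real.smoothTransition.nonneg _),
    abs_of_nonneg (Real.smoothTransition.nonneg _)]
  exact mul_le_one₀ (Real.smoothTransition.le_one _) (Real.smoothTransition.nonneg _)
    (Real.smoothTransition.le_one _)

lemma isInner_arcCutoff_mul (a : ℝ) {δ : ℝ} (hδ : 0 < δ) {φ : ℝ × ℝ → ℝ} (hφ : ContDiff ℝ ∞ φ) :
    IsInner a fun p => arcCutoff a δ p * φ p := by
  refine ⟨(contDiff_arcCutoff a δ).mul hφ, δ / 2, by positivity, fun p hp => ?_⟩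
  have : arcCutoff a δ p = 0 := by
    rw [arcCutoff]
    rcases hp with hp | hp
    · rw [Real.smoothTransition.zero_of_nonpos, zero_mul]
      exact div_nonpos_of_nonpos_of_nonneg (by linarith) (by positivity)
    · rw [mul_comm, Real.smoothTransition.zero_of_nonpos, zero_mul]
      exact div_nonpos_of_nonpos_of_nonneg (by linarith) (by positivity)
  rw [this, zero_mul]

lemma eventually_dirDeriv_congr {f g : ℝ × ℝ → ℝ} {p : ℝ × ℝ} (h : f =ᶠ[nhds p] g) (e : ℝ × ℝ) :
    dirDeriv e f =ᶠ[nhds p] dirDeriv e g := by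
  filter_upwards [h.eventuallyEq_nhds] with x hx using dirDeriv_congr hx e

lemma arcCutoff_mul_eventuallyEq {a δ : ℝ} (hδ : 0 < δ) (φ : ℝ × ℝ → ℝ) {p : ℝ × ℝ}
    (h1 : a + δ < p.1) (h2 : p.1 < a + 2 * Real.pi - δ) :
    (fun p => arcCutoff a δ p * φ p) =ᶠ[nhds p] φ := by
  have hopen : IsOpen {p : ℝ × ℝ | a + δ < p.1 ∧ p.1 < a + 2 * Real.pi - δ} :=
    (isOpen_lt continuous_const continuous_fst).inter (isOpen_lt continuous_fst continuous_const)
  filter_upwards [hopen.mem_nhds ⟨h1, h2⟩] with x hx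
  rw [arcCutoff_eq_one hδ hx.1.le hx.2.le, one_mul]

/-- Integration by parts in `x` on the cylinder. -/
lemma integral_mul_dx_periodize {T : ℝ} {u v : Torus × ℝ → ℝ} (hu : MemLp u 2 (cylinder T))
    (hv : MemLp v 2 (cylinder T))
    (h : ∀ᵐ t ∂(volume.restrict (Ioo 0 T)), HasH1Deriv (fun x => u (x, t)) (fun x => v (x, t)))
    {a : ℝ} {g : ℝ × ℝ → ℝ} (hg : IsInner a g) (hc : HasCompactSupport g) :
    ∫ p, u p * periodize a (dirDeriv (1, 0) g) p ∂(cylinder T)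
      = - ∫ p, v p * periodize a g p ∂(cylinder T) := by
  have hint : ∀ {w : Torus × ℝ → ℝ} {m : ℝ × ℝ → ℝ}, MemLp w 2 (cylinder T) → ContDiff ℝ ∞ m →
      HasCompactSupport m → Integrable (fun p => w p * periodize a m p)
        ((volume : Measure Torus).prod (volume.restrict (Ioo 0 T))) := by
    intro w m hw hm hmc
    obtain ⟨C, hC⟩ := hmc.exists_bound_of_continuous hm.continuous
    exact (hw.integrable (by norm_num)).mul_bdd (c := C)
      (measurable_periodize a hm.continuous.measurable).aestronglyMeasurable
      (Filter.Eventually.of_forall fun p => hC _)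
  rw [cylinder, integral_prod_symm _ (hint hu (hg.dirDeriv (1, 0)).contDiff
      (hasCompactSupport_dirDeriv hc _)), integral_prod_symm _ (hint hv hg.contDiff hc),
    ← integral_neg]
  refine integral_congr_ae (h.mono fun t ht => ?_)
  beta_reduce
  rw [← ht.integral_eq _ (smoothOnTorus_periodize hg t)]
  simp only [torusDeriv_periodize hg]

/-- Cutting the torus inside an arc where the solution vanishes gives a compactly supported
solution on the line. -/
lemma planeSolution_indicator {c T : ℝ} {q u v : Torus × ℝ → ℝ}
    (hq : AEStronglyMeasurable q (cylinder T)) {M : ℝ} (hM : 0 ≤ M)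
    (hqM : ∀ᵐ p ∂(cylinder T), |q p| ≤ M)
    (hu : MemLp u 2 (cylinder T)) (hv : MemLp v 2 (cylinder T))
    (hd : ∀ᵐ t ∂(volume.restrict (Ioo 0 T)), HasH1Deriv (fun x => u (x, t)) (fun x => v (x, t)))
    (hsol : ∀ φ : Torus × ℝ → ℝ, IsTestFunction T φ →
      ∫ p, (- (u p * dt φ p) + u p * dt (dx (dx φ)) p + c * (u p * dx (dx (dx φ)) p)
        + q p * v p * φ p) ∂(cylinder T) = 0)
    {a δ : ℝ} (hδ : 0 < δ)
    (hzero : ∀ᵐ p ∂(volume.restrict (Ioc a (a + 2 * Real.pi) ×ˢ Ioo 0 T)),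
      p.1 ≤ a + δ ∨ a + 2 * Real.pi - δ ≤ p.1 → u (toCylinder p) = 0) :
    PlaneSolution c T a (a + 2 * Real.pi) M
      ((Ioc a (a + 2 * Real.pi) ×ˢ Ioo 0 T).indicator fun p => q (toCylinder p))
      ((Ioc a (a + 2 * Real.pi) ×ˢ Ioo 0 T).indicator fun p => u (toCylinder p))
      ((Ioc a (a + 2 * Real.pi) ×ˢ Ioo 0 T).indicator
        fun p => arcCutoff a δ p * v (toCylinder p)) := by
  set Q : Set (ℝ × ℝ) := Ioc a (a + 2 * Real.pi) ×ˢ Ioo 0 T with hQdef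
  have hQ : MeasurableSet Q := measurableSet_Ioc.prod measurableSet_Ioo
  have hmp := measurePreserving_toCylinder a T
  have hper : ∀ {g : ℝ × ℝ → ℝ} {p : ℝ × ℝ}, p ∈ Q → periodize a g (toCylinder p) = g p :=
    fun {g p} hp => periodize_coe g hp.1 p.2
  have hcut := contDiff_arcCutoff a δ
  have hind : ∀ (w m : ℝ × ℝ → ℝ), ∫ p, Q.indicator w p * m p = ∫ p in Q, w p * m p := by
    intro w m
    rw [← integral_indicator hQ]
    congr 1
    ext p
    by_cases hp : p ∈ Q <;> simp [hp]
  have hvcut : MemLp (fun p => arcCutoff a δ p * v (toCylinder p)) 2 (volume.restrict Q) := by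
    have hv' : MemLp (fun p => v (toCylinder p)) 2 (volume.restrict Q) :=
      hv.comp_measurePreserving hmp
    refine hv'.of_le (hcut.continuous.aestronglyMeasurable.mul hv'.1)
      (Filter.Eventually.of_forall fun p => ?_)
    rw [norm_mul]
    exact mul_le_of_le_one_left (norm_nonneg _) (abs_arcCutoff_le a δ p)
  have hmper : ∀ {g : ℝ × ℝ → ℝ}, ContDiff ℝ ∞ g →
      AEStronglyMeasurable (periodize a g) (cylinder T) := fun hg =>
    (measurable_periodize a hg.continuous.measurable).aestronglyMeasurable
  refine ⟨?_, ?_, fun p hp => indicator_of_notMem hp _, fun p hp => indicator_of_notMem hp _,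
    ?_, ?_, ?_, ?_⟩
  · rw [memLp_indicator_iff_restrict hQ]
    exact hu.comp_measurePreserving hmp
  · rwa [memLp_indicator_iff_restrict hQ]
  · rw [aestronglyMeasurable_indicator_iff hQ]
    exact hq.comp_measurePreserving hmp
  · filter_upwards [(ae_restrict_iff' hQ).1 (hmp.quasiMeasurePreserving.ae hqM)] with p hp
    by_cases hpQ : p ∈ Q
    · rw [indicator_of_mem hpQ]
      exact hp hpQ
    · rwa [indicator_of_notMem hpQ, abs_zero]
  -- Test with the cut-off times `φ`. Where the cut-off differs from `1`, `u` vanishes almost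
  -- everywhere, so `u` does not see its derivatives. On the other side the cut-off lands on `v`, so
  -- it need not be shown that `v` vanishes where `u` does.
  · intro φ hφ hc
    have hin := isInner_arcCutoff_mul a hδ hφ
    have hcs : HasCompactSupport fun p => arcCutoff a δ p * φ p := hc.mul_left
    have h1 := integral_mul_dx_periodize hu hv hd hin hcs
    have h2 := integral_cylinder a T (hu.1.mul (hmper (hin.dirDeriv (1, 0)).contDiff))
    have h3 := integral_cylinder a T (hv.1.mul (hmper hin.contDiff))
    simp only [Pi.mul_apply] at h2 h3
    rw [hind, hind]
    refine Eq.trans ?_ ((h2.symm.trans (h1.trans (congrArg Neg.neg h3))).trans ?_)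
    · refine integral_congr_ae ?_
      filter_upwards [hzero, ae_restrict_mem hQ] with p hp hpQ
      by_cases hcase : p.1 ≤ a + δ ∨ a + 2 * Real.pi - δ ≤ p.1
      · rw [hp hcase, zero_mul, zero_mul]
      · push Not at hcase
        rw [hper hpQ, dirDeriv_congr (arcCutoff_mul_eventuallyEq hδ φ hcase.1 hcase.2)]
    · congr 1
      refine setIntegral_congr_fun hQ fun p hp => ?_
      rw [hper hp]
      ring
  · intro φ hφ hc ht
    have hin := isInner_arcCutoff_mul a hδ hφ
    have htest : IsTestFunction T (periodize a fun p => arcCutoff a δ p * φ p) := by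
      obtain ⟨ε, hε, h⟩ := ht
      exact isTestFunction_periodize hin ⟨ε, hε, fun p hp => h p (right_ne_zero_of_mul hp)⟩
    have hx := hin.dirDeriv (1, 0)
    have hxx := hx.dirDeriv (1, 0)
    have h1 := hsol _ htest
    rw [dx_periodize hin, dx_periodize hx, dx_periodize hxx, dt_periodize hin.contDiff,
      dt_periodize hxx.contDiff, integral_cylinder a T] at h1
    · refine Eq.trans ?_ h1
      rw [← integral_indicator hQ]
      refine integral_congr_ae ?_
      filter_upwards [(ae_restrict_iff' hQ).1 hzero] with p hp
      by_cases hpQ : p ∈ Q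
      · simp only [indicator_of_mem hpQ]
        rw [hper hpQ, hper hpQ, hper hpQ, hper hpQ]
        by_cases hcase : p.1 ≤ a + δ ∨ a + 2 * Real.pi - δ ≤ p.1
        · rw [hp hpQ hcase]
          ring
        · push Not at hcase
          have ev := arcCutoff_mul_eventuallyEq hδ φ hcase.1 hcase.2
          have evx := eventually_dirDeriv_congr ev (1, 0)
          have evxx := eventually_dirDeriv_congr evx (1, 0)
          rw [dirDeriv_congr ev, dirDeriv_congr evxx, dirDeriv_congr evxx]
          ring
      · simp only [indicator_of_notMem hpQ]
        ring
    · have m1 := hmper (hin.dirDeriv (0, 1)).contDiff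
      have m2 := hmper (hxx.dirDeriv (0, 1)).contDiff
      have m3 := hmper (hxx.dirDeriv (1, 0)).contDiff
      have m4 := hmper hin.contDiff
      exact ((((hu.1.mul m1).neg.add (hu.1.mul m2)).add ((hu.1.mul m3).const_mul c)).add
        ((hq.mul hv.1).mul m4))

/-- The uniform bound concerns a weak derivative chosen separately for each `t`; uniqueness
(`HasH1Deriv.ae_eq`) transfers it to the slices of `v`. Bounded slices over a finite time interval
are square integrable. -/
lemma MemLinftyH1.memLp {T : ℝ} {u v : Torus × ℝ → ℝ} (hu : MemLinftyH1 T u) (hv : IsWeakDx T u v) :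
    MemLp u 2 (cylinder T) ∧ MemLp v 2 (cylinder T) := by
  obtain ⟨hum, C, hC⟩ := hu
  have key : ∀ᵐ t ∂(volume.restrict (Ioo 0 T)), HasH1Deriv (fun x => u (x, t)) (fun x => v (x, t)) ∧
      (∫ x, u (x, t) ^ 2) ≤ C ^ 2 ∧ (∫ x, v (x, t) ^ 2) ≤ C ^ 2 := by
    filter_upwards [hC, hv.2] with t ht hvt
    obtain ⟨g, hg, hle⟩ := ht
    have h1 : 0 ≤ ∫ x, u (x, t) ^ 2 := integral_nonneg fun x => sq_nonneg _
    have h2 : 0 ≤ ∫ x, g x ^ 2 := integral_nonneg fun x => sq_nonneg _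
    have h3 : ∫ x, v (x, t) ^ 2 = ∫ x, g x ^ 2 := by
      refine integral_congr_ae ?_
      filter_upwards [hvt.ae_eq hg] with x hx
      rw [hx]
    have hsq := Real.sq_sqrt (add_nonneg h1 h2)
    have hpow := pow_le_pow_left₀ (Real.sqrt_nonneg _) hle 2
    rw [hsq] at hpow
    refine ⟨hvt, ?_, ?_⟩
    · linarith
    · rw [h3]
      linarith
  exact ⟨memLp_cylinder hum (key.mono fun t ht => ⟨ht.1.memLp, ht.2.1⟩),
    memLp_cylinder hv.1 (key.mono fun t ht => ⟨ht.1.memLp_deriv, ht.2.2⟩)⟩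

end KdVBBM

end

theorem corollary5p4 (c : ℝ) (hc : c ≠ 0) (T : ℝ) (hT : 2 * Real.pi / |c| < T)
    (q : KdVBBM.Torus × ℝ → ℝ) (hq : MemLp q ⊤ (KdVBBM.cylinder T))
    (ω : Set KdVBBM.Torus) (hω : IsOpen ω) (hω_ne : ω.Nonempty)
    (u : KdVBBM.Torus × ℝ → ℝ) (hu : KdVBBM.MemLinftyH1 T u)
    (hsol : KdVBBM.IsWeakSolution c T q u)
    (hzero : ∀ᵐ p ∂(KdVBBM.cylinder T), p.1 ∈ ω → u p = 0) :
    ∀ᵐ p ∂(KdVBBM.cylinder T), u p = 0 := by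
  obtain ⟨v, hv, hweak⟩ := hsol
  obtain ⟨hu2, hv2⟩ := hu.memLp hv
  obtain ⟨y, hy⟩ := hω_ne
  obtain ⟨a, -, rfl⟩ := KdVBBM.exists_mem_Ioc_coe 0 y
  have hopen : IsOpen {x : ℝ | (x : KdVBBM.Torus) ∈ ω} :=
    hω.preimage (AddCircle.continuous_mk' (2 * Real.pi))
  obtain ⟨r, hr, hball⟩ := Metric.isOpen_iff.1 hopen a hy
  have hmp := KdVBBM.measurePreserving_toCylinder a T
  have hqM : ∀ᵐ p ∂(KdVBBM.cylinder T), |q p| ≤ (eLpNorm q ⊤ (KdVBBM.cylinder T)).toReal := by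
    have := ae_le_eLpNormEssSup (f := q) (μ := KdVBBM.cylinder T)
    filter_upwards [this] with p hp
    rw [← eLpNorm_exponent_top] at hp
    rw [← Real.norm_eq_abs, ← toReal_enorm]
    exact ENNReal.toReal_mono hq.2.ne hp
  have hzero' : ∀ᵐ p ∂(volume.restrict (Ioc a (a + 2 * Real.pi) ×ˢ Ioo 0 T)),
      p.1 ≤ a + r / 2 ∨ a + 2 * Real.pi - r / 2 ≤ p.1 → u (KdVBBM.toCylinder p) = 0 := by
    filter_upwards [hmp.quasiMeasurePreserving.ae hzero,
      ae_restrict_mem (measurableSet_Ioc.prod measurableSet_Ioo)] with p hp hpQ hcase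
    refine hp ?_
    -- The torus is cut at a point `a` of `ω`. Near the left end `p.1` is close to `a`; near the
    -- right end `p.1 - 2π` is.
    rcases hcase with h | h
    · refine @hball p.1 ?_
      rw [Metric.mem_ball, Real.dist_eq, abs_lt]
      constructor <;> linarith [hpQ.1.1]
    · have hmem : ((p.1 - 2 * Real.pi : ℝ) : KdVBBM.Torus) ∈ ω := by
        refine @hball (p.1 - 2 * Real.pi) ?_
        rw [Metric.mem_ball, Real.dist_eq, abs_lt]
        constructor <;> linarith [hpQ.1.2]
      rwa [AddCircle.coe_sub, AddCircle.coe_period, sub_zero] at hmem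
  have S := KdVBBM.planeSolution_indicator hq.1 ENNReal.toReal_nonneg hqM hu2 hv2 hv.2 hweak
    (half_pos hr) hzero'
  -- The condition on `T` says that a characteristic travels further than the width `2π` of the
  -- rectangle.
  have hlen : a + 2 * Real.pi - a < |c| * T := by
    rw [div_lt_iff₀ (abs_pos.2 hc)] at hT
    linarith
  have hQ : MeasurableSet (Ioc a (a + 2 * Real.pi) ×ˢ Ioo 0 T) :=
    measurableSet_Ioc.prod measurableSet_Ioo
  have hn : eLpNorm u 2 (KdVBBM.cylinder T) = 0 := by
    rw [← eLpNorm_comp_measurePreserving hu2.1 hmp]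
    refine (eLpNorm_congr_ae (g := 0) ?_).trans eLpNorm_zero
    refine (ae_restrict_iff' hQ).2 ?_
    filter_upwards [S.ae_eq_zero hc hlen] with p hp hpQ
    rwa [indicator_of_mem hpQ] at hp
  rw [eLpNorm_eq_zero_iff hu2.1 (by norm_num)] at hn
  exact hn
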